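/- Consider the synchronous language with threads $$T ::= 0 \mid T;T \mid \mathsf{emit}\ s \mid \nu s\,T \mid \mathsf{thread}\ T \mid \mathsf{await}\ s \mid \mathsf{watch}\ s\ T \mid A(\vec s),$$ where signal names $s$ range over a countably infinite set and thread identifiers are defined by a finite system of recursive equations, one equation $A(\vec x)=T$ for each identifier, in which the signal names free in $T$ are among $\vec x$. A program is a finite non-empty multiset of threads together with such a system. Fix sets $\mathit{Input}$ and $\mathit{Output}$ of signal names such that infinitely many signal names lie outside $\mathit{Input}\cup\mathit{Output}$. An environment is a partial function from signal names to $\{\mathsf{true},\mathsf{false}\}$. An instant $P\xrightarrow{I/O}P'$ of $P$ with input $I\subseteq\mathit{Input}$ starts in the environment in which the signals in $I$ are true, the other signals that belong to $\mathit{Input}\cup\mathit{Output}$ or are free in $P$ are false, and all others are undefined. The threads are then reduced in an arbitrary interleaving: $0;T$ becomes $T$; $\mathsf{emit}\ s$ sets $s$ to true and becomes $0$; $\nu s\,T$ takes for $s$ a name on which the environment is undefined, sets it to false and becomes $T$; $\mathsf{thread}\ T$ adds $T$ to the multiset and becomes $0$; $\mathsf{await}\ s$ becomes $0$ provided $s$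 is true; $\mathsf{watch}\ s\ 0$ becomes $0$; $A(\vec s)$ is unfolded; and reduction is allowed in $T$ inside $T;T'$ and $\mathsf{watch}\ s\ T$. When no thread can be reduced, the instant ends: $O$ is the set of signals in $\mathit{Output}$ that are then true, and $P'$ is obtained by replacing with $0$ every $\mathsf{watch}\ s\ T$ in evaluation position whose signal $s$ is true. A program is reactive if it belongs to the largest set $\mathcal R$ of programs such that for all $P\in\mathcal R$ and $I\subseteq \mathit{Input}$ there are $O$ and $P'\in\mathcal R$ with $P\xrightarrow{I/O}P'$. A run is a sequence $P\xrightarrow{I_1/O_1}P_1\xrightarrow{I_2/O_2}\cdots$; it is complete if it is infinite, or finite and not extendable; it emits on $s$ if $s\in O_n$ for some $n$. A deterministic 2-counter machine has finitely many states, at most one instruction per state, and an initial state with initial contents of its two counters. The instructions are: increment a counter and go to $q'$; decrement a non-zero counter and go to $q'$ (not applicable if the counter is zero); go to $q'$ if a counter is zero and to $q''$ otherwise. Its computation terminates if it reaches a configuration without successor. Theorem. Let $s\in\mathit{Output}\setminus\mathit{Input}$. There is a computable function that maps every deterministic 2-counter machine $M$ to a reactive program $P_M$ of the above language (signal generation $\nu$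 being allowed) that eventually emits on $s$ if and only if the computation of $M$ terminates. More precisely, if the computation of $M$ terminates then every complete run of $P_M$, for whatever inputs, emits on $s$; and if it does not terminate then no run of $P_M$ emits on $s$. -/

import Mathlib

/-! ### Deterministic 2-counter machines -/

namespace CounterMachine

/-- Instructions of a 2-counter machine; `q`, `q'` are the target states.
`inc c q` increments counter `c`; `dec c q` decrements counter `c` and is applicable only when the
counter is not zero; `test c q q'` goes to `q` if counter `c` is zero and to `q'` otherwise. -/
inductive Instr where
  | inc (c : Fin 2) (q : ℕ)
  | dec (c : Fin 2) (q : ℕ)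
  | test (c : Fin 2) (q q' : ℕ)

/-- A deterministic 2-counter machine. The states are natural numbers; the instruction of state `q`
is the `q`-th entry of the finite list `code`, and a state outside the list carries no instruction.
The initial configuration consists of `start` and the counter contents `init`. -/
structure Machine where
  code : List Instr
  start : ℕ
  init : Fin 2 → ℕ

structure Config where
  state : ℕ
  cnt : Fin 2 → ℕ

/-- The effect of an instruction on the counters, `none` if it is not applicable. -/
def Instr.exec : Instr → (Fin 2 → ℕ) → Option Config
  | .inc c q, v => some ⟨q, Function.update v c (v c + 1)⟩
  | .dec c q, v => if v c = 0 then none else some ⟨q, Function.update v c (v c - 1)⟩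
  | .test c q q', v => some ⟨if v c = 0 then q else q', v⟩

/-- The (partial) transition function. -/
def Machine.next (M : Machine) (k : Config) : Option Config :=
  match M.code[k.state]? with
  | none => none
  | some i => i.exec k.cnt

def Machine.initial (M : Machine) : Config := ⟨M.start, M.init⟩

/-- The computation of `M` is finite: from the initial configuration, a configuration is reached
that has no successor. -/
def Machine.Terminates (M : Machine) : Prop :=
  ∃ k, Relation.ReflTransGen (fun k k' => M.next k = some k') M.initial k ∧ M.next k = none

/-- Codings of instructions and machines, used to speak of computable functions on machines. -/
def Instr.equivSum : Instr ≃ (Fin 2 × ℕ) ⊕ (Fin 2 × ℕ) ⊕ (Fin 2 × ℕ × ℕ) where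
  toFun
    | .inc c q => .inl (c, q)
    | .dec c q => .inr (.inl (c, q))
    | .test c q q' => .inr (.inr (c, q, q'))
  invFun
    | .inl (c, q) => .inc c q
    | .inr (.inl (c, q)) => .dec c q
    | .inr (.inr (c, q, q')) => .test c q q'
  left_inv i := by cases i <;> rfl
  right_inv x := by rcases x with _ | _ | _ <;> rfl

instance : Primcodable Instr := Primcodable.ofEquiv _ Instr.equivSum

def Machine.equivProd : Machine ≃ List Instr × ℕ × (Fin 2 → ℕ) where
  toFun M := (M.code, M.start, M.init)
  invFun x := ⟨x.1, x.2.1, x.2.2⟩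
  left_inv _ := rfl
  right_inv _ := rfl

instance : Primcodable Machine := Primcodable.ofEquiv _ Machine.equivProd

end CounterMachine

/-! ### The synchronous language -/

namespace SL

/-- An occurrence of a signal name in a thread: a signal `sig s` (signal names are natural
numbers) or a bound name `var i` in de Bruijn notation. Terms up to renaming of bound names are thus
represented by unique terms. -/
inductive Name where
  | sig (s : ℕ)
  | var (i : ℕ)

/-- Threads. `nu T` is `ν s T`, where `var 0` in `T` stands for the bound `s`; `call A xs` is
`A(xs)`, the identifier `A` being a natural number. -/
inductive Thread where
  | nil
  | seq (T T' : Thread)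
  | emit (x : Name)
  | nu (T : Thread)
  | thread (T : Thread)
  | await (x : Name)
  | watch (x : Name) (T : Thread)
  | call (A : ℕ) (xs : List Name)

/-- An equation `A(x₀, …, xₙ₋₁) = T`: `arity` is `n`, and `var i` stands for `xᵢ` in `body`. -/
structure Equation where
  arity : ℕ
  body : Thread

/-- A program together with the finite system of equations that defines its thread identifiers:
the identifier `A` is defined by the `A`-th equation. -/
structure Program where
  eqs : List Equation
  threads : List Thread

/-- Instantiate the names `var k, …, var (k + σ.length - 1)` by the signals in `σ`. -/
def Name.inst (k : ℕ) (σ : List ℕ) : Name → Name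
  | .sig s => .sig s
  | .var i =>
    if i < k then .var i
    else match σ[i - k]? with
      | some s => .sig s
      | none => .var (i - σ.length)

/-- Instantiate the names `var k, …, var (k + σ.length - 1)` by the signals in `σ`, where `k` is the
number of binders crossed. -/
def Thread.inst (k : ℕ) (σ : List ℕ) : Thread → Thread
  | .nil => .nil
  | .seq T T' => .seq (T.inst k σ) (T'.inst k σ)
  | .emit x => .emit (x.inst k σ)
  | .nu T => .nu (T.inst (k + 1) σ)
  | .thread T => .thread (T.inst k σ)
  | .await x => .await (x.inst k σ)
  | .watch x T => .watch (x.inst k σ) (T.inst k σ)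
  | .call A xs => .call A (xs.map (Name.inst k σ))

/-- The signals occurring at a name. -/
def Name.sigs : Name → Set ℕ
  | .sig s => {s}
  | .var _ => ∅

/-- The set of signals free in a thread. -/
def Thread.sigs : Thread → Set ℕ
  | .nil => ∅
  | .seq T T' => T.sigs ∪ T'.sigs
  | .emit x => x.sigs
  | .nu T => T.sigs
  | .thread T => T.sigs
  | .await x => x.sigs
  | .watch x T => x.sigs ∪ T.sigs
  | .call _ xs => {s | ∃ x ∈ xs, s ∈ x.sigs}

/-- The set of signals free in a multiset of threads. -/
def progSigs (P : Multiset Thread) : Set ℕ := {s | ∃ T ∈ P, s ∈ T.sigs}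

/-- All de Bruijn indices at this name are less than `k`. -/
def Name.Closed (k : ℕ) : Name → Prop
  | .sig _ => True
  | .var i => i < k

/-- A well-formed thread with at most the variables `0, …, k - 1`, over a system of equations:
bound names are bound, and each call is to a defined identifier with the right number of
arguments. -/
def Thread.WF (D : List Equation) : ℕ → Thread → Prop
  | _, .nil => True
  | k, .seq T T' => T.WF D k ∧ T'.WF D k
  | k, .emit x => x.Closed k
  | k, .nu T => T.WF D (k + 1)
  | k, .thread T => T.WF D k
  | k, .await x => x.Closed k
  | k, .watch x T => x.Closed k ∧ T.WF D k
  | k, .call A xs => (∃ e, D[A]? = some e ∧ e.arity = xs.length) ∧ ∀ x ∈ xs, x.Closed k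

/-- A well-formed program: a non-empty finite multiset of threads, with equations whose right-hand
sides have no free signal names other than the parameters. -/
def Program.WF (p : Program) : Prop :=
  p.threads ≠ [] ∧ (∀ T ∈ p.threads, T.WF p.eqs 0) ∧
    ∀ e ∈ p.eqs, e.body.WF p.eqs e.arity ∧ e.body.sigs = ∅

/-- Environments: partial functions from signal names to booleans. -/
abbrev Env := ℕ → Option Bool

/-- Thread reduction: `Step D T E P T' E'` is `(T, E) →^P (T', E')`, where `P` is the multiset of
spawned threads. The last two rules close the reduction of redexes under the evaluation contexts
`C ::= [ ] | C; T | watch s C`. -/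
inductive Step (D : List Equation) : Thread → Env → Multiset Thread → Thread → Env → Prop
  | seqNil (T : Thread) (E : Env) : Step D (.seq .nil T) E 0 T E
  | emit (s : ℕ) (E : Env) :
      Step D (.emit (.sig s)) E 0 .nil (Function.update E s (some true))
  | watchNil (s : ℕ) (E : Env) : Step D (.watch (.sig s) .nil) E 0 .nil E
  | nu (T : Thread) (E : Env) (s : ℕ) (hs : E s = none) :
      Step D (.nu T) E 0 (T.inst 0 [s]) (Function.update E s (some false))
  | call (A : ℕ) (σ : List ℕ) (E : Env) (e : Equation) (he : D[A]? = some e)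
      (hσ : e.arity = σ.length) :
      Step D (.call A (σ.map Name.sig)) E 0 (e.body.inst 0 σ) E
  | await (s : ℕ) (E : Env) (hs : E s = some true) : Step D (.await (.sig s)) E 0 .nil E
  | thread (T : Thread) (E : Env) : Step D (.thread T) E {T} .nil E
  | seqCtx (T T' U : Thread) (E E' : Env) (P : Multiset Thread) (h : Step D T E P T' E') :
      Step D (.seq T U) E P (.seq T' U) E'
  | watchCtx (s : ℕ) (T T' : Thread) (E E' : Env) (P : Multiset Thread)
      (h : Step D T E P T' E') :
      Step D (.watch (.sig s) T) E P (.watch (.sig s) T') E'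

/-- A thread is suspended if it cannot be reduced. -/
def Thread.Suspended (D : List Equation) (T : Thread) (E : Env) : Prop :=
  ∀ P T' E', ¬ Step D T E P T' E'

/-- Program reduction within an instant: an arbitrary thread performs a reduction step. -/
inductive ProgStep (D : List Equation) : Multiset Thread × Env → Multiset Thread × Env → Prop
  | mk (P P'' : Multiset Thread) (T T' : Thread) (E E' : Env) (h : Step D T E P'' T' E') :
      ProgStep D (P + {T}, E) (P + {T'} + P'', E')

/-- The computation `⌊T⌋_E` at the end of an instant (only used on suspended threads). -/
def Thread.floor (E : Env) : Thread → Thread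
  | .seq T T' => .seq (T.floor E) T'
  | .watch (.sig s) T => if E s = some true then .nil else .watch (.sig s) (T.floor E)
  | T => T

/-- The observable signals; infinitely many signal names are not observable. -/
structure Interface where
  input : Set ℕ
  output : Set ℕ
  infinite_compl : (input ∪ output)ᶜ.Infinite

open Classical in
/-- The environment `E_{I,P}` at the beginning of an instant. -/
noncomputable def startEnv (J : Interface) (I : Set ℕ) (P : Multiset Thread) : Env := fun s =>
  if s ∈ I then some true
  else if s ∈ J.input ∪ J.output ∪ progSigs P then some false
  else none

/-- The transition `P →^{I/O} P'` performed in one instant. -/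
def Instant (J : Interface) (D : List Equation) (P : Multiset Thread) (I O : Set ℕ)
    (P' : Multiset Thread) : Prop :=
  I ⊆ J.input ∧ ∃ (Q : Multiset Thread) (E : Env),
    Relation.ReflTransGen (ProgStep D) (P, startEnv J I P) (Q, E) ∧
    (∀ T ∈ Q, T.Suspended D E) ∧
    O = {s | s ∈ J.output ∧ E s = some true} ∧
    P' = Q.map (Thread.floor E)

/-- Membership in the largest set `R` of programs such that every `P ∈ R` can, for every choice of
the input signals, perform an instant and lead to an element of `R`. -/
def Reactive (J : Interface) (D : List Equation) (P : Multiset Thread) : Prop :=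
  ∃ R : Set (Multiset Thread), P ∈ R ∧
    ∀ Q ∈ R, ∀ I ⊆ J.input, ∃ (O : Set ℕ) (Q' : Multiset Thread),
      Instant J D Q I O Q' ∧ Q' ∈ R

/-- Finite runs, with their words of inputs and outputs. -/
inductive Run (J : Interface) (D : List Equation) :
    Multiset Thread → List (Set ℕ × Set ℕ) → Multiset Thread → Prop
  | nil (P : Multiset Thread) : Run J D P [] P
  | cons (P P' P'' : Multiset Thread) (I O : Set ℕ) (w : List (Set ℕ × Set ℕ))
      (h : Instant J D P I O P') (h' : Run J D P' w P'') : Run J D P ((I, O) :: w) P''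

/-- Some run of the program emits on the signal `s`. -/
def MayEmit (J : Interface) (D : List Equation) (P : Multiset Thread) (s : ℕ) : Prop :=
  ∃ (w : List (Set ℕ × Set ℕ)) (P' : Multiset Thread),
    Run J D P w P' ∧ ∃ io ∈ w, s ∈ io.2

/-- Every complete run of the program, that is every run which is infinite or which is finite and
cannot be extended, emits on the signal `s`. -/
def MustEmit (J : Interface) (D : List Equation) (P : Multiset Thread) (s : ℕ) : Prop :=
  (∀ (Q : ℕ → Multiset Thread) (I O : ℕ → Set ℕ), Q 0 = P →
      (∀ n, Instant J D (Q n) (I n) (O n) (Q (n + 1))) → ∃ n, s ∈ O n) ∧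
  (∀ (w : List (Set ℕ × Set ℕ)) (P' : Multiset Thread), Run J D P w P' →
      (∀ I O P'', ¬ Instant J D P' I O P'') → ∃ io ∈ w, s ∈ io.2)

/-! Codings of names, threads and programs, used to speak of computable functions into programs. -/

def Name.equivSum : Name ≃ ℕ ⊕ ℕ where
  toFun
    | .sig s => .inl s
    | .var i => .inr i
  invFun
    | .inl s => .sig s
    | .inr i => .var i
  left_inv x := by cases x <;> rfl
  right_inv x := by cases x <;> rfl

instance : Denumerable Name := Denumerable.ofEquiv _ Name.equivSum

/-- A Gödel numbering of threads. -/
def Thread.toNat : Thread → ℕ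
  | .nil => 0
  | .seq T T' => 7 * Nat.pair T.toNat T'.toNat + 1
  | .emit x => 7 * Encodable.encode x + 1 + 1
  | .nu T => 7 * T.toNat + 2 + 1
  | .thread T => 7 * T.toNat + 3 + 1
  | .await x => 7 * Encodable.encode x + 4 + 1
  | .watch x T => 7 * Nat.pair (Encodable.encode x) T.toNat + 5 + 1
  | .call A xs => 7 * Nat.pair A (Encodable.encode xs) + 6 + 1

/-- The inverse of the numbering. -/
def Thread.ofNat : ℕ → Thread
  | 0 => .nil
  | n + 1 =>
    have h0 : n / 7 < n + 1 := by omega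
    have h1 : (n / 7).unpair.1 < n + 1 := lt_of_le_of_lt (Nat.unpair_left_le _) h0
    have h2 : (n / 7).unpair.2 < n + 1 := lt_of_le_of_lt (Nat.unpair_right_le _) h0
    match n % 7 with
    | 0 => .seq (Thread.ofNat (n / 7).unpair.1) (Thread.ofNat (n / 7).unpair.2)
    | 1 => .emit (Denumerable.ofNat Name (n / 7))
    | 2 => .nu (Thread.ofNat (n / 7))
    | 3 => .thread (Thread.ofNat (n / 7))
    | 4 => .await (Denumerable.ofNat Name (n / 7))
    | 5 => .watch (Denumerable.ofNat Name (n / 7).unpair.1) (Thread.ofNat (n / 7).unpair.2)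
    | _ => .call (n / 7).unpair.1 (Denumerable.ofNat (List Name) (n / 7).unpair.2)

theorem Thread.ofNat_toNat (T : Thread) : Thread.ofNat T.toNat = T := by
  have key : ∀ a r, r < 7 → (7 * a + r) % 7 = r ∧ (7 * a + r) / 7 = a := by
    intro a r h; omega
  induction T with
  | nil => simp [Thread.toNat, Thread.ofNat]
  | seq T T' h h' =>
    obtain ⟨e1, e2⟩ := key (Nat.pair T.toNat T'.toNat) 0 (by omega)
    rw [Nat.add_zero] at e1 e2
    simp only [Thread.toNat, Thread.ofNat, e1, e2, Nat.unpair_pair, h, h']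
  | emit x =>
    obtain ⟨e1, e2⟩ := key (Encodable.encode x) 1 (by omega)
    simp only [Thread.toNat, Thread.ofNat, e1, e2, Denumerable.ofNat_encode]
  | nu T h =>
    obtain ⟨e1, e2⟩ := key T.toNat 2 (by omega)
    simp only [Thread.toNat, Thread.ofNat, e1, e2, h]
  | thread T h =>
    obtain ⟨e1, e2⟩ := key T.toNat 3 (by omega)
    simp only [Thread.toNat, Thread.ofNat, e1, e2, h]
  | await x =>
    obtain ⟨e1, e2⟩ := key (Encodable.encode x) 4 (by omega)
    simp only [Thread.toNat, Thread.ofNat, e1, e2, Denumerable.ofNat_encode]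
  | watch x T h =>
    obtain ⟨e1, e2⟩ := key (Nat.pair (Encodable.encode x) T.toNat) 5 (by omega)
    simp only [Thread.toNat, Thread.ofNat, e1, e2, Nat.unpair_pair, Denumerable.ofNat_encode, h]
  | call A xs =>
    obtain ⟨e1, e2⟩ := key (Nat.pair A (Encodable.encode xs)) 6 (by omega)
    simp only [Thread.toNat, Thread.ofNat, e1, e2, Nat.unpair_pair, Denumerable.ofNat_encode]

theorem Thread.toNat_ofNat (n : ℕ) : (Thread.ofNat n).toNat = n := by
  induction n using Nat.strong_induction_on with
  | _ n ih =>
    cases n with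
    | zero => simp [Thread.toNat, Thread.ofNat]
    | succ n =>
      have h0 : n / 7 < n + 1 := by omega
      have i0 := ih _ h0
      have i1 := ih _ (lt_of_le_of_lt (Nat.unpair_left_le (n / 7)) h0)
      have i2 := ih _ (lt_of_le_of_lt (Nat.unpair_right_le (n / 7)) h0)
      have hr : n % 7 < 7 := Nat.mod_lt _ (by omega)
      have hd : 7 * (n / 7) + n % 7 = n := Nat.div_add_mod n 7
      rw [Thread.ofNat]
      generalize n % 7 = r at hr hd ⊢
      interval_cases r <;>
        simp only [Thread.toNat, i0, i1, i2, Denumerable.encode_ofNat, Nat.pair_unpair] <;>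
        omega

instance : Denumerable Thread :=
  Denumerable.mk' ⟨Thread.toNat, Thread.ofNat, Thread.ofNat_toNat, Thread.toNat_ofNat⟩

def Equation.equivProd : Equation ≃ ℕ × Thread where
  toFun e := (e.arity, e.body)
  invFun x := ⟨x.1, x.2⟩
  left_inv _ := rfl
  right_inv _ := rfl

instance : Primcodable Equation := Primcodable.ofEquiv _ Equation.equivProd

def Program.equivProd : Program ≃ List Equation × List Thread where
  toFun p := (p.eqs, p.threads)
  invFun x := ⟨x.1, x.2⟩
  left_inv _ := rfl
  right_inv _ := rfl

instance : Primcodable Program := Primcodable.ofEquiv _ Program.equivProd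

end SL

/-! A counter is a stack of suspended threads, one frame per unit. Each frame awaits a private
signal generated by `ν`; one further thread, the top, knows the signal of the topmost frame. To
increment, the top generates a signal, spawns a frame that awaits it and remembers the old status,
and goes on as the top over the new frame. To decrement, it emits the topmost signal, and the
awakened frame becomes the top.

One machine step takes one instant. Both tops announce zero or positive; the control thread reads
the answer of one counter, then either sends a command to each counter and passes to the next state,
or, if the machine is stuck, emits the observed signal. Alternatives not taken sit under a `watch`
on a clock that the control emits, so the end of the instant turns them into `nil`. Inputs cannot
interfere, since neither global nor private signals are inputs.

The difficulty is that every interleaving must give this result. Within an instant a defined signal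
stays defined and a true one stays true, so a step other than `ν` whose emission, if any, is on a
defined signal commutes with every step of another thread. Being available until taken, it can be
moved to the front of any terminating path (`steps_front`); a `ν` can be moved too, with the name
that the path chooses (`steps_front_nu`). Hence one schedule, executed symbolically with `Sim`,
controls all terminating paths.

The schedules are run in `sim_counter` and `sim_ctrl` and assembled in `sim_state_go` and
`sim_state_halt`. By `instants_step` and `instants_halt`, programs representing a configuration
always have an instant, and each of their instants leads to the successor configuration without
emission, or emits and leaves an inert program. Induction along runs and computations finishes the
comparison. Initial counter contents are first compiled into increments (`zeroInit`), and the whole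
translation is primitive recursive. -/

namespace SL

/-! ### Labelled reduction -/

/-- The interaction of a redex with the environment. -/
inductive Label where
  | tau
  | emit (s : ℕ)
  | nu (s : ℕ)
  | await (s : ℕ)

def Label.Enabled : Label → Env → Prop
  | .tau, _ => True
  | .emit _, _ => True
  | .nu s, E => E s = none
  | .await s, E => E s = some true

def Label.effect : Label → Env → Env
  | .tau, E => E
  | .emit s, E => Function.update E s (some true)
  | .nu s, E => Function.update E s (some false)
  | .await _, E => E

/-- Thread reduction with the environment abstracted into a label. -/
inductive LStep (D : List Equation) : Thread → Label → Multiset Thread → Thread → Prop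
  | seqNil (T : Thread) : LStep D (.seq .nil T) .tau 0 T
  | emit (s : ℕ) : LStep D (.emit (.sig s)) (.emit s) 0 .nil
  | watchNil (s : ℕ) : LStep D (.watch (.sig s) .nil) .tau 0 .nil
  | nu (T : Thread) (s : ℕ) : LStep D (.nu T) (.nu s) 0 (T.inst 0 [s])
  | call (A : ℕ) (σ : List ℕ) (e : Equation) (he : D[A]? = some e) (hσ : e.arity = σ.length) :
      LStep D (.call A (σ.map Name.sig)) .tau 0 (e.body.inst 0 σ)
  | await (s : ℕ) : LStep D (.await (.sig s)) (.await s) 0 .nil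
  | thread (T : Thread) : LStep D (.thread T) .tau {T} .nil
  | seqCtx {T T' U : Thread} {a : Label} {P : Multiset Thread} (h : LStep D T a P T') :
      LStep D (.seq T U) a P (.seq T' U)
  | watchCtx {s : ℕ} {T T' : Thread} {a : Label} {P : Multiset Thread} (h : LStep D T a P T') :
      LStep D (.watch (.sig s) T) a P (.watch (.sig s) T')

variable {D : List Equation}

theorem step_iff_lstep {T T' : Thread} {E E' : Env} {P : Multiset Thread} :
    Step D T E P T' E' ↔ ∃ a, LStep D T a P T' ∧ a.Enabled E ∧ E' = a.effect E := by
  constructor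
  · intro h
    induction h with
    | seqNil T E => exact ⟨_, .seqNil T, trivial, rfl⟩
    | emit s E => exact ⟨_, .emit s, trivial, rfl⟩
    | watchNil s E => exact ⟨_, .watchNil s, trivial, rfl⟩
    | nu T E s hs => exact ⟨_, .nu T s, hs, rfl⟩
    | call A σ E e he hσ => exact ⟨_, .call A σ e he hσ, trivial, rfl⟩
    | await s E hs => exact ⟨_, .await s, hs, rfl⟩
    | thread T E => exact ⟨_, .thread T, trivial, rfl⟩
    | seqCtx T T' U E E' P h ih =>
      obtain ⟨a, h1, h2⟩ := ih
      exact ⟨a, .seqCtx h1, h2⟩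
    | watchCtx s T T' E E' P h ih =>
      obtain ⟨a, h1, h2⟩ := ih
      exact ⟨a, .watchCtx h1, h2⟩
  · rintro ⟨a, h, he, rfl⟩
    induction h with
    | seqNil T => exact .seqNil T E
    | emit s => exact .emit s E
    | watchNil s => exact .watchNil s E
    | nu T s => exact .nu T E s he
    | call A σ e he' hσ => exact .call A σ E e he' hσ
    | await s => exact .await s E he
    | thread T => exact .thread T E
    | seqCtx h ih => exact .seqCtx _ _ _ _ _ _ (ih he)
    | watchCtx h ih => exact .watchCtx _ _ _ _ _ _ (ih he)

/-- Reduction is deterministic up to the choice of the generated signal. -/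
theorem LStep.unique {T T₁ T₂ : Thread} {a b : Label} {P₁ P₂ : Multiset Thread}
    (h₁ : LStep D T a P₁ T₁) (h₂ : LStep D T b P₂ T₂) :
    (a = b ∧ P₁ = P₂ ∧ T₁ = T₂) ∨ ∃ s t, a = .nu s ∧ b = .nu t := by
  induction h₁ generalizing b P₂ T₂ with
  | seqNil T =>
    cases h₂ with
    | seqNil => simp
    | seqCtx h => cases h
  | emit s => cases h₂; simp
  | watchNil s =>
    cases h₂ with
    | watchNil => simp
    | watchCtx h => cases h
  | nu T s => cases h₂; simp
  | call A σ e he hσ =>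
    generalize hxs : σ.map Name.sig = xs at h₂
    rcases h₂ with _ | _ | _ | _ | ⟨_, σ', e', he', hσ'⟩
    have hinj : Function.Injective Name.sig := fun x y h => by cases h; rfl
    have := List.map_injective_iff.2 hinj hxs
    subst this
    rw [he] at he'
    cases he'
    simp
  | await s => cases h₂; simp
  | thread T => cases h₂; simp
  | seqCtx h ih =>
    cases h₂ with
    | seqNil => cases h
    | seqCtx h' =>
      rcases ih h' with ⟨rfl, rfl, rfl⟩ | h
      · simp
      · exact .inr h
  | watchCtx h ih =>
    cases h₂ with
    | watchNil => cases h
    | watchCtx h' =>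
      rcases ih h' with ⟨rfl, rfl, rfl⟩ | h
      · simp
      · exact .inr h

theorem progStep_iff {P Q : Multiset Thread} {E F : Env} :
    ProgStep D (P, E) (Q, F) ↔ ∃ T R a P'' T', P = T ::ₘ R ∧ LStep D T a P'' T' ∧ a.Enabled E ∧
      Q = T' ::ₘ (P'' + R) ∧ F = a.effect E := by
  constructor
  · intro h
    cases h with
    | mk R P'' T T' _ _ h =>
      obtain ⟨a, h1, h2, h3⟩ := step_iff_lstep.1 h
      refine ⟨T, R, a, P'', T', ?_, h1, h2, ?_, h3⟩
      · rw [← Multiset.singleton_add]; abel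
      · rw [← Multiset.singleton_add]; abel
  · rintro ⟨T, R, a, P'', T', rfl, h1, h2, rfl, rfl⟩
    have := ProgStep.mk R P'' T T' E _ (step_iff_lstep.2 ⟨a, h1, h2, rfl⟩)
    convert this using 2
    · rw [← Multiset.singleton_add]; abel
    · rw [← Multiset.singleton_add]; abel

/-- Multisets of threads that are all suspended in the given environment. -/
def Final (D : List Equation) (c : Multiset Thread × Env) : Prop :=
  ∀ T ∈ c.1, T.Suspended D c.2

abbrev Steps (D : List Equation) := Relation.ReflTransGen (ProgStep D)

/-! ### Moving a reduction to the front of a path -/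

/-- The signal emitted, if any, belongs to the domain of the environment. -/
def Label.Safe : Label → Env → Prop
  | .tau, _ => True
  | .emit s, E => E s ≠ none
  | .nu _, _ => False
  | .await _, _ => True

theorem Label.effect_ne_none {a : Label} {E : Env} {s : ℕ} (h : E s ≠ none) :
    a.effect E s ≠ none := by
  cases a <;> simp only [effect, Function.update_apply] <;> try split_ifs
  all_goals simp_all

theorem Label.effect_true {a : Label} {E : Env} {s : ℕ} (ha : a.Enabled E)
    (h : E s = some true) : a.effect E s = some true := by
  cases a <;> simp only [effect, Function.update_apply] <;> try split_ifs
  all_goals simp_all [Enabled]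

/-- Defined signals stay defined and true ones stay true, so an await stays enabled. Two emissions
write the same value. An emission on an undefined name could disable a `ν` choosing that name, which
is what `Safe` excludes. -/
theorem Label.commute {a b : Label} {E : Env} (ha : a.Enabled E) (hs : a.Safe E)
    (hb : b.Enabled E) :
    a.Enabled (b.effect E) ∧ a.Safe (b.effect E) ∧ b.Enabled (a.effect E) ∧
      b.effect (a.effect E) = a.effect (b.effect E) := by
  refine ⟨?_, ?_, ?_, ?_⟩
  · cases a with
    | await s => exact effect_true hb ha
    | nu s => exact hs.elim
    | _ => trivial
  · cases a with
    | emit s => exact effect_ne_none hs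
    | nu s => exact hs.elim
    | _ => trivial
  · cases b with
    | await s => exact effect_true ha hb
    | nu s =>
      cases a with
      | emit t =>
        have : s ≠ t := by rintro rfl; exact hs hb
        simpa [effect, Enabled, this] using hb
      | nu t => exact hs.elim
      | _ => exact hb
    | _ => trivial
  · cases a with
    | nu s => exact hs.elim
    | emit s =>
      cases b with
      | emit t =>
        by_cases h : s = t
        · subst h; rfl
        · exact Function.update_comm h _ _ _
      | nu t =>
        have : s ≠ t := by rintro rfl; exact hs hb
        exact Function.update_comm this _ _ _
      | _ => rfl
    | _ => rfl

/-- The path cannot end before `T` has moved, since `T` is not suspended. Every step that the path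
takes before that belongs to another thread and commutes with `a`; when `T` moves, `LStep.unique`
forces the same step. -/
theorem steps_front {T T' : Thread} {a : Label} {P'' : Multiset Thread}
    (h : LStep D T a P'' T') {c d : Multiset Thread × Env} (hcd : Steps D c d)
    (hd : Final D d) {R : Multiset Thread} {E : Env} (hc : c = (T ::ₘ R, E))
    (ha : a.Enabled E) (hs : a.Safe E) :
    Steps D (T' ::ₘ (P'' + R), a.effect E) d := by
  induction hcd using Relation.ReflTransGen.head_induction_on generalizing R E with
  | refl =>
    subst hc
    exact absurd (step_iff_lstep.2 ⟨a, h, ha, rfl⟩) (hd T (by simp) _ _ _)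
  | head h1 h2 ih =>
    subst hc
    rename_i c'
    obtain ⟨Q, F⟩ := c'
    obtain ⟨T₁, R₁, b, P₁, T₁', hR, hl, hb, rfl, rfl⟩ := progStep_iff.1 h1
    -- Equal threads of the multiset need not be told apart: if the path reduces another copy of
    -- `T`, the resulting multiset is the same.
    rcases Multiset.cons_eq_cons.1 hR with ⟨rfl, rfl⟩ | ⟨-, W, rfl, rfl⟩
    · rcases h.unique hl with ⟨rfl, rfl, rfl⟩ | ⟨s, t, rfl, rfl⟩
      · exact h2
      · exact hs.elim
    · obtain ⟨c1, c2, c3, c4⟩ := Label.commute ha hs hb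
      have := ih (R := T₁' ::ₘ (P₁ + W)) (E := b.effect E)
        (by simp only [← Multiset.singleton_add]; congr 1; abel) c1 c2
      refine Relation.ReflTransGen.head ?_ this
      refine progStep_iff.2 ⟨T₁, T' ::ₘ (P'' + W), b, P₁, T₁', ?_, hl, c3, ?_, c4.symm⟩ <;>
      · simp only [← Multiset.singleton_add]; abel

theorem Label.infinite_undefined {a : Label} {E : Env} (h : {s | E s = none}.Infinite) :
    {s | a.effect E s = none}.Infinite := by
  have key : ∀ t v, {s | Function.update E t (some v) s = none}.Infinite := by
    intro t v
    refine (h.sdiff (Set.finite_singleton t)).mono ?_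
    rintro s ⟨h1, h2⟩
    have : s ≠ t := h2
    simpa [this] using h1
  cases a <;> first | exact h | exact key _ _

/-- The name `s` is read off from the path. The infinite supply of undefined names keeps the `ν`
reducible, so the path must reduce it before ending; the name chosen then was undefined all along
and can be reserved at once. -/
theorem steps_front_nu {T : Thread} {c d : Multiset Thread × Env} (hcd : Steps D c d)
    (hd : Final D d) {R : Multiset Thread} {E : Env} (hc : c = (.nu T ::ₘ R, E))
    (hE : {s | E s = none}.Infinite) :
    ∃ s, E s = none ∧ Steps D (T.inst 0 [s] ::ₘ R, Function.update E s (some false)) d := by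
  induction hcd using Relation.ReflTransGen.head_induction_on generalizing R E with
  | refl =>
    subst hc
    obtain ⟨s, hs⟩ := hE.nonempty
    exact absurd (Step.nu T E s hs) (hd (.nu T) (by simp) _ _ _)
  | head h1 h2 ih =>
    subst hc
    rename_i c'
    obtain ⟨Q, F⟩ := c'
    obtain ⟨T₁, R₁, b, P₁, T₁', hR, hl, hb, rfl, rfl⟩ := progStep_iff.1 h1
    rcases Multiset.cons_eq_cons.1 hR with ⟨rfl, rfl⟩ | ⟨-, W, rfl, rfl⟩
    · cases hl with
      | nu _ s => exact ⟨s, hb, by simpa [Label.effect] using h2⟩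
    · obtain ⟨s, hs, this⟩ := ih (R := T₁' ::ₘ (P₁ + W)) (E := b.effect E)
        (by simp only [← Multiset.singleton_add]; congr 1; abel) (Label.infinite_undefined hE)
      have hs' : E s = none := by
        by_contra hne
        exact Label.effect_ne_none hne hs
      refine ⟨s, hs', Relation.ReflTransGen.head ?_ this⟩
      refine progStep_iff.2 ⟨T₁, T.inst 0 [s] ::ₘ W, b, P₁, T₁', ?_, hl, ?_, ?_, ?_⟩
      · simp only [← Multiset.singleton_add]; abel
      -- The step `b` leaves `s` undefined, so it neither emits nor generates `s`, and it cannot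
      -- have awaited `s`. It is therefore unaffected by setting `s` to false beforehand.
      · cases b with
        | await t =>
          have : t ≠ s := by rintro rfl; simp [Label.Enabled, hs'] at hb
          simpa [Label.Enabled, this] using hb
        | nu t =>
          have : t ≠ s := by rintro rfl; simp [Label.effect] at hs
          simpa [Label.Enabled, this] using hb
        | _ => trivial
      · simp only [← Multiset.singleton_add]; abel
      · cases b with
        | emit t =>
          have : t ≠ s := by rintro rfl; simp [Label.effect] at hs
          exact Function.update_comm this _ _ _
        | nu t =>
          have : t ≠ s := by rintro rfl; simp [Label.effect] at hs
          exact Function.update_comm this _ _ _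
        | _ => rfl

/-! ### Symbolic execution of an instant -/

/-- Some path from `(P, E)` terminates, and all terminating paths end in `S`. -/
def Sim (D : List Equation) (P : Multiset Thread) (E : Env)
    (S : Multiset Thread → Env → Prop) : Prop :=
  (∃ d, Steps D (P, E) d ∧ Final D d) ∧ ∀ d, Steps D (P, E) d → Final D d → S d.1 d.2

variable {S : Multiset Thread → Env → Prop} {E : Env} {R : Multiset Thread}

theorem Sim.final {P : Multiset Thread} (h : Final D (P, E)) (hS : S P E) : Sim D P E S := by
  refine ⟨⟨_, .refl, h⟩, fun d hd _ => ?_⟩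
  rcases Relation.ReflTransGen.cases_head hd with rfl | ⟨⟨Q, F⟩, h1, -⟩
  · exact hS
  · obtain ⟨T, R, a, P'', T', rfl, hl, ha, -⟩ := progStep_iff.1 h1
    exact absurd (step_iff_lstep.2 ⟨a, hl, ha, rfl⟩) (h T (by simp) _ _ _)

/-- The scheduler may be assumed to pick this step first: `steps_front` rearranges any terminating
path accordingly. -/
theorem Sim.step {T T' : Thread} {a : Label} {P : Multiset Thread} (h : LStep D T a P T')
    (ha : a.Enabled E) (hs : a.Safe E) (hS : Sim D (T' ::ₘ (P + R)) (a.effect E) S) :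
    Sim D (T ::ₘ R) E S := by
  refine ⟨?_, fun d hd hF => hS.2 d (steps_front h hd hF rfl ha hs) hF⟩
  obtain ⟨d, hd, hF⟩ := hS.1
  exact ⟨d, .head (progStep_iff.2 ⟨T, R, a, P, T', rfl, h, ha, rfl, rfl⟩) hd, hF⟩

theorem Sim.tau {T T' : Thread} (h : LStep D T .tau 0 T') (hS : Sim D (T' ::ₘ R) E S) :
    Sim D (T ::ₘ R) E S :=
  Sim.step h trivial trivial (by simpa [Label.effect] using hS)

theorem Sim.spawn {T T' U : Thread} (h : LStep D T .tau {U} T')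
    (hS : Sim D (T' ::ₘ U ::ₘ R) E S) : Sim D (T ::ₘ R) E S :=
  Sim.step h trivial trivial (by simpa [Label.effect] using hS)

theorem Sim.emit {T T' : Thread} {s : ℕ} (h : LStep D T (.emit s) 0 T') (hs : E s ≠ none)
    (hS : Sim D (T' ::ₘ R) (Function.update E s (some true)) S) : Sim D (T ::ₘ R) E S :=
  Sim.step h trivial hs (by simpa [Label.effect] using hS)

theorem Sim.await {T T' : Thread} {s : ℕ} (h : LStep D T (.await s) 0 T')
    (hs : E s = some true) (hS : Sim D (T' ::ₘ R) E S) : Sim D (T ::ₘ R) E S :=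
  Sim.step h hs trivial (by simpa [Label.effect] using hS)

/-- Only the choice of the fresh name remains nondeterministic, so all choices must be treated. -/
theorem Sim.nu {T : Thread} (hE : {s | E s = none}.Infinite)
    (hS : ∀ s, E s = none → Sim D (T.inst 0 [s] ::ₘ R) (Function.update E s (some false)) S) :
    Sim D (.nu T ::ₘ R) E S := by
  constructor
  · obtain ⟨s, hs⟩ := hE.nonempty
    obtain ⟨d, hd, hF⟩ := (hS s hs).1
    exact ⟨d, .head (progStep_iff.2 ⟨_, R, .nu s, 0, _, rfl, .nu T s, hs, by simp, rfl⟩) hd, hF⟩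
  · intro d hd hF
    obtain ⟨s, hs, h⟩ := steps_front_nu hd hF rfl hE
    exact (hS s hs).2 d h hF

theorem Sim.seq_emit {U : Thread} {s : ℕ} (hs : E s ≠ none)
    (hS : Sim D (U ::ₘ R) (Function.update E s (some true)) S) :
    Sim D (.seq (.emit (.sig s)) U ::ₘ R) E S :=
  Sim.emit (.seqCtx (.emit s)) hs (Sim.tau (.seqNil U) hS)

theorem Sim.seq_thread {T U : Thread} (hS : Sim D (U ::ₘ T ::ₘ R) E S) :
    Sim D (.seq (.thread T) U ::ₘ R) E S :=
  Sim.spawn (.seqCtx (.thread T)) (Sim.tau (.seqNil U) hS)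

theorem Sim.seq_await {U : Thread} {s : ℕ} (hs : E s = some true) (hS : Sim D (U ::ₘ R) E S) :
    Sim D (.seq (.await (.sig s)) U ::ₘ R) E S :=
  Sim.await (.seqCtx (.await s)) hs (Sim.tau (.seqNil U) hS)

/-- A thread spawned under a `watch` lies outside it. Thus `T` can survive the end of the instant,
while the spent `watch` leaves only `nil`. -/
theorem Sim.watch_await_thread {T : Thread} {k s : ℕ} (hs : E s = some true)
    (hS : Sim D (T ::ₘ .nil ::ₘ R) E S) :
    Sim D (.watch (.sig k) (.seq (.await (.sig s)) (.thread T)) ::ₘ R) E S := by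
  refine Sim.await (.watchCtx (.seqCtx (.await s))) hs (Sim.tau (.watchCtx (.seqNil _)) ?_)
  refine Sim.spawn (.watchCtx (.thread T)) (Sim.tau (.watchNil k) ?_)
  rwa [Multiset.cons_swap]

theorem Sim.watch_await_emit {k s t : ℕ} (hs : E s = some true) (ht : E t ≠ none)
    (hS : Sim D (.nil ::ₘ R) (Function.update E t (some true)) S) :
    Sim D (.watch (.sig k) (.seq (.await (.sig s)) (.emit (.sig t))) ::ₘ R) E S := by
  refine Sim.await (.watchCtx (.seqCtx (.await s))) hs (Sim.tau (.watchCtx (.seqNil _)) ?_)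
  exact Sim.emit (.watchCtx (.emit t)) ht (Sim.tau (.watchNil k) hS)

/-! ### Suspended threads -/

theorem suspended_nil : Thread.Suspended D .nil E := by
  intro P T' E' h; cases h

/-- `T` is about to await a signal that is not true. -/
def Thread.Blocked (E : Env) : Thread → Prop
  | .await (.sig s) => E s ≠ some true
  | .seq T _ => T.Blocked E
  | .watch (.sig _) T => T.Blocked E
  | _ => False

theorem Thread.Blocked.suspended {T : Thread} (h : T.Blocked E) : T.Suspended D E := by
  intro P T' E' hs
  induction hs with
  | await s E hs => exact h hs
  | seqCtx T T' U E E' P _ ih => exact ih h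
  | watchCtx s T T' E E' P _ ih => exact ih h
  | _ => exact h.elim

/-! ### Defined and undefined signals at the beginning of an instant -/

theorem Thread.finite_sigs (T : Thread) : T.sigs.Finite := by
  have hn : ∀ x : Name, x.sigs.Finite := by rintro (s | i) <;> simp [Name.sigs]
  induction T with
  | nil => exact Set.finite_empty
  | seq T T' h h' => exact h.union h'
  | emit x => exact hn x
  | nu T h => exact h
  | thread T h => exact h
  | await x => exact hn x
  | watch x T h => exact (hn x).union h
  | call A xs =>
    have : (⋃ x ∈ {x | x ∈ xs}, x.sigs).Finite :=
      Set.Finite.biUnion (List.finite_toSet xs) fun x _ => hn x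
    refine this.subset ?_
    rintro s ⟨x, hx, hs⟩
    simp only [Set.mem_iUnion]
    exact ⟨x, hx, hs⟩

theorem finite_progSigs (P : Multiset Thread) : (progSigs P).Finite := by
  have : (⋃ T ∈ {T | T ∈ P}, T.sigs).Finite := by
    refine Set.Finite.biUnion ?_ fun T _ => T.finite_sigs
    induction P using Multiset.induction_on with
    | empty => simp
    | cons T P ih =>
      have : {U | U ∈ T ::ₘ P} = insert T {U | U ∈ P} := by ext; simp
      rw [this]
      exact ih.insert T
  refine this.subset ?_
  rintro s ⟨T, hT, hs⟩
  simp only [Set.mem_iUnion]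
  exact ⟨T, hT, hs⟩

/-- The interface leaves infinitely many names unobservable, and a program mentions only finitely
many of them. -/
theorem infinite_startEnv (J : Interface) {I : Set ℕ} (hI : I ⊆ J.input) (P : Multiset Thread) :
    {s | startEnv J I P s = none}.Infinite := by
  refine (J.infinite_compl.sdiff (finite_progSigs P)).mono ?_
  rintro s ⟨h1, h2⟩
  have h3 : s ∉ J.input := fun h => h1 (.inl h)
  have h4 : s ∉ J.output := fun h => h1 (.inr h)
  have h5 : s ∉ I := fun h => h3 (hI h)
  simp [startEnv, h2, h3, h4, h5]

theorem startEnv_ne_none {J : Interface} {I : Set ℕ} {P : Multiset Thread} {s : ℕ}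
    (h : s ∈ J.input ∪ J.output ∪ progSigs P) : startEnv J I P s ≠ none := by
  unfold startEnv
  split_ifs <;> simp

theorem startEnv_eq_false {J : Interface} {I : Set ℕ} (hI : I ⊆ J.input) {P : Multiset Thread}
    {s : ℕ} (h : s ∈ J.input ∪ J.output ∪ progSigs P) (hs : s ∉ J.input) :
    startEnv J I P s = some false := by
  unfold startEnv
  rw [if_neg fun h => hs (hI h), if_pos h]

theorem startEnv_ne_true {J : Interface} {I : Set ℕ} (hI : I ⊆ J.input) {P : Multiset Thread}
    {s : ℕ} (hs : s ∉ J.input) : startEnv J I P s ≠ some true := by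
  unfold startEnv
  rw [if_neg fun h => hs (hI h)]
  split_ifs <;> simp

/-- The instants of a program, in terms of symbolic execution. -/
theorem Sim.instants {J : Interface} {P : Multiset Thread} {I : Set ℕ} (hI : I ⊆ J.input)
    {K : Set ℕ → Multiset Thread → Prop}
    (h : Sim D P (startEnv J I P)
      fun Q E => K {s | s ∈ J.output ∧ E s = some true} (Q.map (Thread.floor E))) :
    (∃ O P', Instant J D P I O P') ∧ ∀ O P', Instant J D P I O P' → K O P' := by
  constructor
  · obtain ⟨⟨Q, E⟩, hd, hF⟩ := h.1
    exact ⟨_, _, hI, Q, E, hd, hF, rfl, rfl⟩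
  · rintro O P' ⟨-, Q, E, hd, hF, rfl, rfl⟩
    exact h.2 (Q, E) hd hF

end SL

namespace SL

/-! ### The encoding

Control threads have thirteen global signals as parameters: `0` is a clock that is emitted at every
instant, `1` is never emitted, `2` is the observed output, and `chan c o` for `o = 0, …, 4` are the
channels of the counter `c`: the commands to increment, decrement and keep the counter, and the
answers that it is zero and that it is positive.

A counter is a stack of frames, each waiting for a private signal; the thread at the top knows the
signal of the topmost frame. -/

def chan (c : Fin 2) (o : Fin 5) : ℕ := 3 + 5 * c + o

/-- Wait for the next instant, provided that the clock `k` is emitted and `r` is not. -/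
def waitT (k r : Name) : Thread := .watch k (.await r)

/-- On `s` run `T`, in the present instant only. -/
def branchT (k s : Name) (T : Thread) : Thread := .watch k (.seq (.await s) T)

/-- Push a frame: `var 0` is the signal of the new frame. -/
def pushT (k r i d s p st x : Name) : Thread :=
  .seq (.thread (.seq (.await (.var 0)) (.seq (waitT k r) (.call 0 [k, r, i, d, s, p, st, x]))))
    (.seq (waitT k r) (.call 0 [k, r, i, d, s, p, p, .var 0]))

/-- The thread at the top of a counter: it emits its status `st` and obeys one of the commands
`i`, `d`, `s`. -/
def topT (k r i d s p st x : Name) (push : Thread) : Thread :=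
  .seq (.emit st) (.seq (.thread (branchT k i (.thread push)))
    (.seq (.thread (branchT k d (.emit x)))
      (branchT k s (.thread (.seq (waitT k r) (.call 0 [k, r, i, d, s, p, st, x]))))))

/-- The parameters are the clock, the signal never emitted, the commands to increment, decrement and
keep, the answer "positive", the current answer, and the signal of the topmost frame. Under `nu`
their indices move up by one. -/
def topEq : Equation :=
  ⟨8, topT (.var 0) (.var 1) (.var 2) (.var 3) (.var 4) (.var 5) (.var 6) (.var 7)
    (.nu (pushT (.var 1) (.var 2) (.var 3) (.var 4) (.var 5) (.var 6) (.var 7) (.var 8)))⟩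

/-- What the control does upon the answer of a counter: send commands to both counters and go to
an identifier, or halt. -/
abbrev Act := Option ((Fin 5 × Fin 5) × ℕ)

/-- The naming `nm` is `.var` in the equations and `sigG g` in running threads; `inst_actT` passes
from one to the other. -/
def actT (nm : ℕ → Name) : Act → Thread
  | none => .emit (nm 2)
  | some ((a, b), A) => .seq (.emit (nm (chan 0 a))) (.seq (.emit (nm (chan 1 b)))
      (.seq (waitT (nm 0) (nm 1)) (.call A ((List.range 13).map nm))))

/-- The control thread that asks the counter `c`. -/
def ctrlT (nm : ℕ → Name) (c : Fin 2) (z p : Act) : Thread :=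
  .seq (.emit (nm 0)) (.seq (.thread (branchT (nm 0) (nm (chan c 3)) (.thread (actT nm z))))
    (branchT (nm 0) (nm (chan c 4)) (.thread (actT nm p))))

def ctrlEq (c : Fin 2) (z p : Act) : Equation := ⟨13, ctrlT .var c z p⟩

/-- Truncated subtraction does no harm, since decrements are only sent to positive counters. -/
def opEffect (o : Fin 5) (n : ℕ) : ℕ := if o = 0 then n + 1 else if o = 1 then n - 1 else n

/-! ### Behaviour of counters and control, with `g` naming the global signals -/

section Semantics

variable {D : List Equation} {S : Multiset Thread → Env → Prop} {E : Env} {R : Multiset Thread}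
  (g : ℕ → ℕ)

def statusChan (c : Fin 2) (xs : List ℕ) : ℕ := chan c (if xs = [] then 3 else 4)

/-- The arguments of the top of counter `c` over frames with the signals `xs`. -/
def topArgs (c : Fin 2) (xs : List ℕ) : List ℕ :=
  [g 0, g 1, g (chan c 0), g (chan c 1), g (chan c 2), g (chan c 4), g (statusChan c xs),
    xs.headD (g 0)]

def topCall (c : Fin 2) (xs : List ℕ) : Thread := .call 0 ((topArgs g c xs).map .sig)

def waitG : Thread := waitT (.sig (g 0)) (.sig (g 1))

/-- The frame remembers what lies below it: awakened by `x`, it sits out the instant and becomes the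
top over `xs`. -/
def frameT (c : Fin 2) (x : ℕ) (xs : List ℕ) : Thread :=
  .seq (.await (.sig x)) (.seq (waitG g) (topCall g c xs))

def frames (c : Fin 2) : List ℕ → Multiset Thread
  | [] => 0
  | x :: xs => frameT g c x xs ::ₘ frames c xs

def pushG (c : Fin 2) (xs : List ℕ) : Thread :=
  pushT (.sig (g 0)) (.sig (g 1)) (.sig (g (chan c 0))) (.sig (g (chan c 1)))
    (.sig (g (chan c 2))) (.sig (g (chan c 4))) (.sig (g (statusChan c xs)))
    (.sig (xs.headD (g 0)))

def branchG (i : ℕ) (T : Thread) : Thread := branchT (.sig (g 0)) (.sig (g i)) T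

def incBranch (c : Fin 2) (xs : List ℕ) : Thread :=
  branchG g (chan c 0) (.thread (.nu (pushG g c xs)))

/-- On an empty stack the clock `g 0` is a mere placeholder; `sim_counter` excludes a decrement
there. -/
def decBranch (c : Fin 2) (xs : List ℕ) : Thread :=
  branchG g (chan c 1) (.emit (.sig (xs.headD (g 0))))

def keepBranch (c : Fin 2) (xs : List ℕ) : Thread :=
  branchG g (chan c 2) (.thread (.seq (waitG g) (topCall g c xs)))

variable {g}

theorem chan_lt (c : Fin 2) (o : Fin 5) : chan c o < 13 := by
  unfold chan; omega

theorem chan_inj {c c' : Fin 2} {o o' : Fin 5} : chan c o = chan c' o' ↔ c = c' ∧ o = o' := by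
  unfold chan; omega

theorem three_le_chan (c : Fin 2) (o : Fin 5) : 3 ≤ chan c o := by
  unfold chan; omega

theorem sim_top (hD : D[0]? = some topEq) {c : Fin 2} {xs : List ℕ}
    (hst : E (g (statusChan c xs)) ≠ none)
    (hS : Sim D (keepBranch g c xs ::ₘ decBranch g c xs ::ₘ incBranch g c xs ::ₘ R)
      (Function.update E (g (statusChan c xs)) (some true)) S) :
    Sim D (.seq .nil (topCall g c xs) ::ₘ R) E S := by
  refine Sim.tau (.seqNil _) (Sim.tau (.call 0 (topArgs g c xs) topEq hD rfl) ?_)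
  exact Sim.seq_emit hst (Sim.seq_thread (Sim.seq_thread hS))

/-- Invariant of the environment during an instant; `l` lists the signals of the frames. -/
structure Inv (J : Interface) (g : ℕ → ℕ) (E : Env) (l : List ℕ) : Prop where
  undef : {s | E s = none}.Infinite
  glob : ∀ i < 13, E (g i) ≠ none
  input : ∀ s ∈ J.input, E s ≠ none
  nodup : l.Nodup
  frame : ∀ x ∈ l, E x = some false ∧ x ∉ J.input ∧ ∀ i < 13, x ≠ g i

theorem Inv.perm {J : Interface} {l l' : List ℕ} (h : Inv J g E l) (hl : l.Perm l') :
    Inv J g E l' :=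
  ⟨h.undef, h.glob, h.input, hl.nodup_iff.1 h.nodup, fun x hx => h.frame x (hl.mem_iff.2 hx)⟩

theorem Inv.emit {J : Interface} {l : List ℕ} (h : Inv J g E l) {i : ℕ} (hi : i < 13) :
    Inv J g (Function.update E (g i) (some true)) l where
  undef := Label.infinite_undefined (a := .emit (g i)) h.undef
  glob j hj := Label.effect_ne_none (a := .emit (g i)) (h.glob j hj)
  input s hs := Label.effect_ne_none (a := .emit (g i)) (h.input s hs)
  nodup := h.nodup
  frame x hx := by
    obtain ⟨h1, h2, h3⟩ := h.frame x hx
    exact ⟨by simpa [h3 i hi] using h1, h2, h3⟩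

/-- Global signals, inputs and the signals of existing frames are all defined, so an undefined `y`
differs from each of them. -/
theorem Inv.push {J : Interface} {l : List ℕ} (h : Inv J g E l) {y : ℕ} (hy : E y = none) :
    Inv J g (Function.update E y (some false)) (y :: l) where
  undef := Label.infinite_undefined (a := .nu y) h.undef
  glob j hj := Label.effect_ne_none (a := .nu y) (h.glob j hj)
  input s hs := Label.effect_ne_none (a := .nu y) (h.input s hs)
  nodup := by
    refine List.nodup_cons.2 ⟨fun hm => ?_, h.nodup⟩
    simp [(h.frame y hm).1] at hy
  frame x hx := by
    rcases List.mem_cons.1 hx with rfl | hx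
    · refine ⟨by simp, fun hm => h.input x hm hy, ?_⟩
      rintro i hi rfl
      exact h.glob i hi hy
    · obtain ⟨h1, h2⟩ := h.frame x hx
      have : x ≠ y := by rintro rfl; simp [h1] at hy
      exact ⟨by simpa [this] using h1, h2⟩

/-- Distinctness of the frame signals ensures that emitting `x` wakes no other frame. -/
theorem Inv.pop {J : Interface} {l : List ℕ} {x : ℕ} (h : Inv J g E (x :: l)) :
    Inv J g (Function.update E x (some true)) l where
  undef := Label.infinite_undefined (a := .emit x) h.undef
  glob j hj := Label.effect_ne_none (a := .emit x) (h.glob j hj)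
  input s hs := Label.effect_ne_none (a := .emit x) (h.input s hs)
  nodup := (List.nodup_cons.1 h.nodup).2
  frame y hy := by
    obtain ⟨h1, h2⟩ := h.frame y (List.mem_cons_of_mem _ hy)
    have : y ≠ x := by rintro rfl; exact (List.nodup_cons.1 h.nodup).1 hy
    exact ⟨by simpa [this] using h1, h2⟩

/-- Threads that are reduced to `nil` at the end of an instant in which the clock is emitted. -/
def Killed (g : ℕ → ℕ) (E : Env) (T : Thread) : Prop :=
  T = .nil ∨ ∃ i < 13, E (g i) ≠ some true ∧ ∃ U, T = branchG g i U

theorem Killed.congr {E' : Env} (h : ∀ i < 13, E' (g i) = E (g i)) {T : Thread}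
    (hT : Killed g E T) : Killed g E' T := by
  rcases hT with rfl | ⟨i, hi, h1, h2⟩
  · exact .inl rfl
  · exact .inr ⟨i, hi, by rwa [h i hi], h2⟩

theorem killed_branch {i : ℕ} (hi : i < 13) (h : E (g i) ≠ some true) (U : Thread) :
    Killed g E (branchG g i U) :=
  .inr ⟨i, hi, h, U, rfl⟩

/-- Execution of the command `o` by the counter `c`. -/
theorem sim_counter {J : Interface} {c : Fin 2} {o : Fin 5} (ho : o.val < 3) {xs ys : List ℕ}
    (hinv : Inv J g E (xs ++ ys)) (hop : E (g (chan c o)) = some true)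
    (hne : ∀ o' : Fin 5, o'.val < 3 → o' ≠ o → E (g (chan c o')) ≠ some true)
    (hdec : o = 1 → xs ≠ [])
    (hS : ∀ xs' E' K, xs'.length = opEffect o xs.length → Inv J g E' (xs' ++ ys) →
      (∀ i < 13, E' (g i) = E (g i)) → (∀ T ∈ K, Killed g E' T) →
      Sim D (.seq (waitG g) (topCall g c xs') ::ₘ (K + frames g c xs' + R)) E' S) :
    Sim D (keepBranch g c xs ::ₘ decBranch g c xs ::ₘ incBranch g c xs ::ₘ (frames g c xs + R))
      E S := by
  have key : ∀ o' : Fin 5, o'.val < 3 → o' ≠ o → ∀ (E' : Env) (U : Thread),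
      (∀ i < 13, E' (g i) = E (g i)) → Killed g E' (branchG g (chan c o') U) :=
    fun o' h1 h2 E' U h =>
      killed_branch (chan_lt _ _) (by rw [h _ (chan_lt _ _)]; exact hne o' h1 h2) U
  have ho' : o = 0 ∨ o = 1 ∨ o = 2 := by omega
  rcases ho' with rfl | rfl | rfl
  · have e : keepBranch g c xs ::ₘ decBranch g c xs ::ₘ incBranch g c xs ::ₘ (frames g c xs + R) =
        incBranch g c xs ::ₘ ({keepBranch g c xs, decBranch g c xs} + frames g c xs + R) := by
      simp only [← Multiset.singleton_add, Multiset.insert_eq_cons]; abel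
    rw [e]
    refine Sim.watch_await_thread hop (Sim.nu hinv.undef fun y hy => ?_)
    have hg : ∀ i < 13, Function.update E y (some false) (g i) = E (g i) := by
      intro i hi
      have : g i ≠ y := by rintro rfl; exact hinv.glob i hi hy
      simp [this]
    refine Sim.seq_thread ?_
    -- The leftovers `K` are the `nil` of the branch taken and the two branches whose commands were
    -- not sent.
    have := hS (y :: xs) _ {.nil, keepBranch g c xs, decBranch g c xs} (by simp [opEffect])
      (hinv.push hy) hg (by
        intro T hT
        simp only [Multiset.insert_eq_cons, Multiset.mem_cons, Multiset.mem_singleton] at hT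
        rcases hT with rfl | rfl | rfl
        · exact .inl rfl
        · exact key 2 (by decide) (by decide) _ _ hg
        · exact key 1 (by decide) (by decide) _ _ hg)
    convert this using 1
    change _ ::ₘ frameT g c y xs ::ₘ _ = _
    simp only [← Multiset.singleton_add, Multiset.insert_eq_cons, frames]
    have : (Thread.seq (waitG g) (topCall g c (y :: xs))) =
      (Thread.inst 0 [y] (.seq (waitT (.sig (g 0)) (.sig (g 1))) (.call 0
        [.sig (g 0), .sig (g 1), .sig (g (chan c 0)), .sig (g (chan c 1)), .sig (g (chan c 2)),
          .sig (g (chan c 4)), .sig (g (chan c 4)), .var 0]))) := rfl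
    rw [this]
    abel
  · cases xs with
    | nil => exact absurd rfl (hdec rfl)
    | cons x xs =>
      have e : keepBranch g c (x :: xs) ::ₘ decBranch g c (x :: xs) ::ₘ incBranch g c (x :: xs) ::ₘ
            (frames g c (x :: xs) + R) =
          decBranch g c (x :: xs) ::ₘ frameT g c x xs ::ₘ
            ({keepBranch g c (x :: xs), incBranch g c (x :: xs)} + frames g c xs + R) := by
        simp only [← Multiset.singleton_add, Multiset.insert_eq_cons, frames]; abel
      rw [e]
      have hx := hinv.frame x (by simp)
      refine Sim.watch_await_emit (t := x) hop (by simp [hx.1]) ?_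
      rw [Multiset.cons_swap]
      refine Sim.seq_await (by simp) ?_
      have hg : ∀ i < 13, Function.update E x (some true) (g i) = E (g i) := by
        intro i hi
        simp [(hx.2.2 i hi).symm]
      have := hS xs _ {.nil, keepBranch g c (x :: xs), incBranch g c (x :: xs)}
        (by simp [opEffect]) hinv.pop hg (by
          intro T hT
          simp only [Multiset.insert_eq_cons, Multiset.mem_cons, Multiset.mem_singleton] at hT
          rcases hT with rfl | rfl | rfl
          · exact .inl rfl
          · exact key 2 (by decide) (by decide) _ _ hg
          · exact key 0 (by decide) (by decide) _ _ hg)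
      convert this using 1
      simp only [← Multiset.singleton_add, Multiset.insert_eq_cons]
      abel
  · refine Sim.watch_await_thread hop ?_
    have := hS xs E {.nil, decBranch g c xs, incBranch g c xs} (by simp [opEffect])
      hinv (fun _ _ => rfl) (by
        intro T hT
        simp only [Multiset.insert_eq_cons, Multiset.mem_cons, Multiset.mem_singleton] at hT
        rcases hT with rfl | rfl | rfl
        · exact .inl rfl
        · exact key 1 (by decide) (by decide) _ _ (fun _ _ => rfl)
        · exact key 0 (by decide) (by decide) _ _ (fun _ _ => rfl))
    convert this using 1
    simp only [← Multiset.singleton_add, Multiset.insert_eq_cons]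
    abel

def sigG (g : ℕ → ℕ) (i : ℕ) : Name := .sig (g i)

def ctrlCall (g : ℕ → ℕ) (A : ℕ) : Thread := .call A ((List.range 13).map (sigG g))

theorem inst_var {i : ℕ} (hi : i < 13) :
    Name.inst 0 ((List.range 13).map g) (.var i) = sigG g i := by
  simp [Name.inst, hi, sigG]

theorem inst_actT (a : Act) : (actT .var a).inst 0 ((List.range 13).map g) = actT (sigG g) a := by
  rcases a with _ | ⟨⟨a, b⟩, A⟩
  · simp [actT, Thread.inst, inst_var]
  · simp only [actT, Thread.inst, waitT, inst_var (chan_lt _ _), inst_var (Nat.succ_pos _),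
      inst_var (show 1 < 13 by decide), List.map_map]
    congr 4

theorem inst_ctrlT (c : Fin 2) (z p : Act) :
    (ctrlT .var c z p).inst 0 ((List.range 13).map g) = ctrlT (sigG g) c z p := by
  simp only [ctrlT, branchT, Thread.inst, inst_actT, inst_var (chan_lt _ _),
    inst_var (Nat.succ_pos _)]

/-- The control thread reads the answer of the counter `c`. -/
theorem sim_ctrl {A : ℕ} {c : Fin 2} {z p : Act} (hD : D[A]? = some (ctrlEq c z p))
    (h0 : E (g 0) ≠ none) (hg : Function.Injective g) (xs : List ℕ)
    (hst : ∀ o : Fin 5, 3 ≤ o.val → (E (g (chan c o)) = some true ↔ chan c o = statusChan c xs))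
    (hS : ∀ K, (∀ E' : Env, (∀ o : Fin 5, 3 ≤ o.val → E' (g (chan c o)) = E (g (chan c o))) →
        ∀ T ∈ K, Killed g E' T) →
      Sim D (actT (sigG g) (if xs = [] then z else p) ::ₘ (K + R))
        (Function.update E (g 0) (some true)) S) :
    Sim D (.seq .nil (ctrlCall g A) ::ₘ R) E S := by
  refine Sim.tau (.seqNil _) ?_
  have hc : ctrlCall g A = .call A (((List.range 13).map g).map .sig) := by
    rw [List.map_map]; rfl
  rw [hc]
  refine Sim.tau (.call A _ _ hD (by simp [ctrlEq])) ?_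
  change Sim D (Thread.inst 0 _ (ctrlT .var c z p) ::ₘ R) E S
  rw [inst_ctrlT]
  refine Sim.seq_emit h0 (Sim.seq_thread ?_)
  have hne : ∀ o, g (chan c o) ≠ g 0 := fun o h => by
    have := three_le_chan c o
    have := hg h
    omega
  have h3 := hst 3 (by decide)
  have h4 := hst 4 (by decide)
  by_cases hx : xs = []
  · simp only [statusChan, hx, if_true, chan_inj] at h3 h4
    rw [Multiset.cons_swap]
    refine Sim.watch_await_thread (s := g (chan c 3)) (by simpa [hne] using h3) ?_
    have := hS {.nil, branchG g (chan c 4) (.thread (actT (sigG g) p))} (by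
      intro E' hE' T hT
      simp only [Multiset.insert_eq_cons, Multiset.mem_cons, Multiset.mem_singleton] at hT
      rcases hT with rfl | rfl
      · exact .inl rfl
      · exact killed_branch (chan_lt _ _) (by simp [hE', h4]) _)
    rw [if_pos hx] at this
    convert this using 1
    simp [branchG, sigG]
  · simp only [statusChan, hx, if_false, chan_inj] at h3 h4
    refine Sim.watch_await_thread (s := g (chan c 4)) (by simpa [hne] using h4) ?_
    have := hS {.nil, branchG g (chan c 3) (.thread (actT (sigG g) z))} (by
      intro E' hE' T hT
      simp only [Multiset.insert_eq_cons, Multiset.mem_cons, Multiset.mem_singleton] at hT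
      rcases hT with rfl | rfl
      · exact .inl rfl
      · exact killed_branch (chan_lt _ _) (by simp [hE', h3]) _)
    rw [if_neg hx] at this
    convert this using 1
    simp [branchG, sigG]

/-! ### The end of an instant -/

theorem Killed.suspended {T : Thread} (h : Killed g E T) : T.Suspended D E := by
  rcases h with rfl | ⟨i, -, hi, U, rfl⟩
  · exact suspended_nil
  · exact Thread.Blocked.suspended hi

theorem Killed.floor {T : Thread} (h : Killed g E T) (h0 : E (g 0) = some true) :
    T.floor E = .nil := by
  rcases h with rfl | ⟨i, -, hi, U, rfl⟩
  · rfl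
  · simp [branchG, branchT, Thread.floor, h0]

theorem mem_frames {c : Fin 2} {xs : List ℕ} {T : Thread} (h : T ∈ frames g c xs) :
    ∃ x ∈ xs, ∃ U, T = .seq (.await (.sig x)) U := by
  induction xs with
  | nil => simp [frames] at h
  | cons x xs ih =>
    rcases Multiset.mem_cons.1 h with rfl | h
    · exact ⟨x, by simp, _, rfl⟩
    · obtain ⟨y, hy, h⟩ := ih h
      exact ⟨y, by simp [hy], h⟩

theorem frame_mem_progSigs {c : Fin 2} {xs : List ℕ} {x : ℕ} (h : x ∈ xs) :
    x ∈ progSigs (frames g c xs) := by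
  induction xs with
  | nil => simp at h
  | cons y xs ih =>
    rcases List.mem_cons.1 h with rfl | h
    · exact ⟨_, Multiset.mem_cons_self _ _, by simp [frameT, Thread.sigs, Name.sigs]⟩
    · obtain ⟨T, hT, hs⟩ := ih h
      exact ⟨T, Multiset.mem_cons_of_mem hT, hs⟩

theorem map_floor_frames {c : Fin 2} {xs : List ℕ} :
    (frames g c xs).map (Thread.floor E) = frames g c xs := by
  conv_rhs => rw [← Multiset.map_id (frames g c xs)]
  refine Multiset.map_congr rfl fun T hT => ?_
  obtain ⟨x, -, U, rfl⟩ := mem_frames hT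
  simp [Thread.floor]

theorem suspended_wait {U : Thread} (h1 : E (g 1) ≠ some true) :
    Thread.Suspended D (.seq (waitG g) U) E :=
  Thread.Blocked.suspended h1

theorem suspended_await {x : ℕ} {U : Thread} (h : E x ≠ some true) :
    Thread.Suspended D (.seq (.await (.sig x)) U) E :=
  Thread.Blocked.suspended h

theorem floor_wait {U : Thread} (h0 : E (g 0) = some true) :
    (Thread.seq (waitG g) U).floor E = .seq .nil U := by
  simp [waitG, waitT, Thread.floor, h0]

/-! ### Instants -/

/-- The program at the beginning of an instant; the threads in `N` have terminated. -/
def stateP (g : ℕ → ℕ) (A : ℕ) (xs : Fin 2 → List ℕ) (N : Multiset Thread) : Multiset Thread :=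
  .seq .nil (ctrlCall g A) ::ₘ .seq .nil (topCall g 0 (xs 0)) ::ₘ
    .seq .nil (topCall g 1 (xs 1)) ::ₘ (frames g 0 (xs 0) + frames g 1 (xs 1) + N)

/-- Programs that control the identifier `A`, the counters having contents `v`. -/
def IsState (J : Interface) (g : ℕ → ℕ) (A : ℕ) (v : Fin 2 → ℕ) (P : Multiset Thread) : Prop :=
  ∃ xs N, P = stateP g A xs N ∧ (∀ c, (xs c).length = v c) ∧ (∀ T ∈ N, T = .nil) ∧
    (xs 0 ++ xs 1).Nodup ∧ ∀ x ∈ xs 0 ++ xs 1, x ∉ J.input ∧ ∀ i < 13, x ≠ g i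

/-- Programs without any activity. -/
def IsDead (J : Interface) (P : Multiset Thread) : Prop :=
  ∀ T ∈ P, T = .nil ∨ ∃ x ∉ J.input, ∃ U, T = .seq (.await (.sig x)) U

/-- All thirteen global signals are arguments of the control call and every private signal occurs in
its frame. Being free in the program and not inputs, they all start as false; in particular no `ν`
can reuse them. -/
theorem inv_start {J : Interface} (hgJ : ∀ i, g i ∉ J.input) {I : Set ℕ} (hI : I ⊆ J.input)
    {A : ℕ} {xs : Fin 2 → List ℕ} {N : Multiset Thread} (hnd : (xs 0 ++ xs 1).Nodup)
    (hx : ∀ x ∈ xs 0 ++ xs 1, x ∉ J.input ∧ ∀ i < 13, x ≠ g i) :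
    Inv J g (startEnv J I (stateP g A xs N)) (xs 0 ++ xs 1) ∧
      ∀ i < 13, startEnv J I (stateP g A xs N) (g i) = some false := by
  have hgl : ∀ i < 13, startEnv J I (stateP g A xs N) (g i) = some false := by
    intro i hi
    refine startEnv_eq_false hI (.inr ⟨_, Multiset.mem_cons_self _ _, ?_⟩) (hgJ i)
    simp only [Thread.sigs, ctrlCall, Set.empty_union, Set.mem_ofPred_eq]
    exact ⟨sigG g i, List.mem_map.2 ⟨i, List.mem_range.2 hi, rfl⟩, rfl⟩
  refine ⟨⟨infinite_startEnv J hI _, fun i hi => by simp [hgl i hi],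
    fun s hs => startEnv_ne_none (.inl (.inl hs)), hnd, fun x hxm => ?_⟩, hgl⟩
  refine ⟨startEnv_eq_false hI (.inr ?_) (hx x hxm).1, hx x hxm⟩
  rcases List.mem_append.1 hxm with h | h
  · obtain ⟨T, hT, hs⟩ := frame_mem_progSigs (g := g) (c := 0) h
    exact ⟨T, by simp [stateP, hT], hs⟩
  · obtain ⟨T, hT, hs⟩ := frame_mem_progSigs (g := g) (c := 1) h
    exact ⟨T, by simp [stateP, hT], hs⟩

/-- The beginning of an instant, up to the action of the control thread. -/
theorem sim_state (hD : D[0]? = some topEq) {J : Interface} (hg : Function.Injective g)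
    {A : ℕ} {c : Fin 2} {z p : Act} (hA : D[A]? = some (ctrlEq c z p))
    {xs : Fin 2 → List ℕ} {N : Multiset Thread} (hN : ∀ T ∈ N, T = .nil)
    (hinv : Inv J g E (xs 0 ++ xs 1)) (hE : ∀ i < 13, E (g i) = some false)
    (hS : ∀ E' K, Inv J g E' (xs 0 ++ xs 1) →
      (∀ i < 13, E' (g i) = some true ↔
        i = 0 ∨ i = statusChan 0 (xs 0) ∨ i = statusChan 1 (xs 1)) →
      (∀ E'' : Env, (∀ (c : Fin 2) (o : Fin 5), 3 ≤ o.val →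
        E'' (g (chan c o)) = E' (g (chan c o))) → ∀ T ∈ K, Killed g E'' T) →
      Sim D (actT (sigG g) (if xs c = [] then z else p) ::ₘ
        (keepBranch g 0 (xs 0) ::ₘ decBranch g 0 (xs 0) ::ₘ incBranch g 0 (xs 0) ::ₘ
          (frames g 0 (xs 0) +
        (keepBranch g 1 (xs 1) ::ₘ decBranch g 1 (xs 1) ::ₘ incBranch g 1 (xs 1) ::ₘ
          (frames g 1 (xs 1) + K))))) E' S) :
    Sim D (stateP g A xs N) E S := by
  have hlt : ∀ c' : Fin 2, statusChan c' (xs c') < 13 := fun c' => chan_lt _ _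
  rw [stateP, Multiset.cons_swap]
  refine sim_top hD (hinv.glob _ (hlt 0)) ?_
  have i1 := hinv.emit (hlt 0)
  set E1 := Function.update E (g (statusChan 0 (xs 0))) (some true) with hE1
  have e : keepBranch g 0 (xs 0) ::ₘ decBranch g 0 (xs 0) ::ₘ incBranch g 0 (xs 0) ::ₘ
      .seq .nil (ctrlCall g A) ::ₘ .seq .nil (topCall g 1 (xs 1)) ::ₘ
      (frames g 0 (xs 0) + frames g 1 (xs 1) + N) =
      .seq .nil (topCall g 1 (xs 1)) ::ₘ .seq .nil (ctrlCall g A) ::ₘ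
      keepBranch g 0 (xs 0) ::ₘ decBranch g 0 (xs 0) ::ₘ incBranch g 0 (xs 0) ::ₘ
      (frames g 0 (xs 0) + frames g 1 (xs 1) + N) := by
    simp only [← Multiset.singleton_add]; abel
  rw [e]
  refine sim_top hD (i1.glob _ (hlt 1)) ?_
  have i2 := i1.emit (hlt 1)
  set E2 := Function.update E1 (g (statusChan 1 (xs 1))) (some true) with hE2
  have e : ∀ X Y : Thread, keepBranch g 1 (xs 1) ::ₘ decBranch g 1 (xs 1) ::ₘ
      incBranch g 1 (xs 1) ::ₘ X ::ₘ Y ::ₘ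
      decBranch g 0 (xs 0) ::ₘ incBranch g 0 (xs 0) ::ₘ
      (frames g 0 (xs 0) + frames g 1 (xs 1) + N) =
      X ::ₘ keepBranch g 1 (xs 1) ::ₘ decBranch g 1 (xs 1) ::ₘ
      incBranch g 1 (xs 1) ::ₘ Y ::ₘ
      decBranch g 0 (xs 0) ::ₘ incBranch g 0 (xs 0) ::ₘ
      (frames g 0 (xs 0) + frames g 1 (xs 1) + N) := by
    intro X Y; simp only [← Multiset.singleton_add]; abel
  rw [e]
  have hval : ∀ i < 13, E2 (g i) = some true ↔
      i = statusChan 0 (xs 0) ∨ i = statusChan 1 (xs 1) := by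
    intro i hi
    simp only [hE2, hE1, Function.update_apply, hg.eq_iff]
    split_ifs with h1 h2
    · simp [h1]
    · simp [h2]
    · simp [h1, h2, hE i hi]
  refine sim_ctrl hA (i2.glob 0 (by decide)) hg (xs c) ?_ ?_
  · intro o ho
    rw [hval _ (chan_lt _ _)]
    simp only [statusChan, chan_inj]
    have : c = 0 ∨ c = 1 := by omega
    rcases this with rfl | rfl <;> simp
  · intro K hK
    have := hS _ (K + N) (i2.emit (i := 0) (by decide)) (by
        intro i hi
        simp only [Function.update_apply, hg.eq_iff]
        split_ifs with h
        · simp [h]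
        · simp [h, hval i hi]) (by
        intro E'' hE'' T hT
        rcases Multiset.mem_add.1 hT with h | h
        · refine hK E'' (fun o ho => ?_) T h
          have : chan c o ≠ 0 := by have := three_le_chan c o; omega
          rw [hE'' c o ho, Function.update_of_ne (hg.ne this)]
        · exact .inl (hN T h))
    convert this using 1
    simp only [← Multiset.singleton_add]; abel

/-- An instant in which the control thread sends the commands `a` and `b` and goes to `A'`. -/
theorem sim_state_go (hD : D[0]? = some topEq) {J : Interface} (hg : Function.Injective g)
    (hgJ : ∀ i, g i ∉ J.input) {I : Set ℕ} (hI : I ⊆ J.input)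
    {A A' : ℕ} {c : Fin 2} {z p : Act} (hA : D[A]? = some (ctrlEq c z p))
    {v : Fin 2 → ℕ} {P : Multiset Thread} (hP : IsState J g A v P) {a b : Fin 5}
    (hact : (if v c = 0 then z else p) = some ((a, b), A')) (ha : a.val < 3) (hb : b.val < 3)
    (ha' : a = 1 → v 0 ≠ 0) (hb' : b = 1 → v 1 ≠ 0) :
    Sim D P (startEnv J I P) fun Q E => E (g 2) ≠ some true ∧
      IsState J g A' ![opEffect a (v 0), opEffect b (v 1)] (Q.map (Thread.floor E)) := by
  obtain ⟨xs, N, rfl, hlen, hN, hnd, hx⟩ := hP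
  obtain ⟨hinv, hE⟩ := inv_start hgJ hI (A := A) (N := N) hnd hx
  refine sim_state hD hg hA hN hinv hE fun E1 K hi1 hv1 hK => ?_
  have hif : (if xs c = [] then z else p) = some ((a, b), A') := by
    rw [← hact, ← hlen c]; simp
  rw [hif]
  refine Sim.seq_emit (hi1.glob _ (chan_lt _ _)) ?_
  have hi2 := hi1.emit (chan_lt 0 a)
  refine Sim.seq_emit (hi2.glob _ (chan_lt _ _)) ?_
  have hi3 := hi2.emit (chan_lt 1 b)
  set E3 := Function.update (Function.update E1 (g (chan 0 a)) (some true))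
    (g (chan 1 b)) (some true) with hE3
  have hv3 : ∀ i < 13, E3 (g i) = some true ↔ i = chan 1 b ∨ i = chan 0 a ∨
      i = 0 ∨ i = statusChan 0 (xs 0) ∨ i = statusChan 1 (xs 1) := by
    intro i hi
    simp only [hE3, Function.update_apply, hg.eq_iff]
    split_ifs with h1 h2
    · simp [h1]
    · simp [h2]
    · simp [h1, h2, hv1 i hi]
  -- Commands have offsets 0, 1, 2 and answers 3, 4, so an announced status never triggers a command
  -- branch.
  have hst : ∀ (o : Fin 5) (c c' : Fin 2) (l : List ℕ), o.val < 3 → chan c o ≠ statusChan c' l := by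
    intro o c c' l ho h
    have := (chan_inj.1 h).2
    split_ifs at this <;> subst this <;> simp at ho
  have hc0 : ∀ (o : Fin 5) (c : Fin 2), chan c o ≠ 0 := fun o c => by
    have := three_le_chan c o; omega
  have hK3 : ∀ E' : Env, (∀ i < 13, E' (g i) = E3 (g i)) → ∀ T ∈ K, Killed g E' T := by
    intro E' hE'
    refine hK E' fun c o ho => ?_
    rw [hE' _ (chan_lt _ _), hE3, Function.update_of_ne, Function.update_of_ne]
    · rw [hg.ne_iff, ne_eq, chan_inj]; rintro ⟨-, rfl⟩; omega
    · rw [hg.ne_iff, ne_eq, chan_inj]; rintro ⟨-, rfl⟩; omega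
  have e : ∀ X Y Z W : Thread, ∀ F R : Multiset Thread,
      X ::ₘ Y ::ₘ Z ::ₘ W ::ₘ (F + R) = Y ::ₘ Z ::ₘ W ::ₘ (F + X ::ₘ R) := by
    intros; simp only [← Multiset.singleton_add]; abel
  rw [e]
  refine sim_counter ha hi3 ((hv3 _ (chan_lt _ _)).2 (by simp)) ?_ ?_ ?_
  · intro o ho hne
    rw [ne_eq, hv3 _ (chan_lt _ _)]
    simp [chan_inj, hne, hc0, hst o _ _ _ ho]
  · intro h h'
    exact ha' h (by simp [← hlen, h'])
  intro xs0 E4 K0 hl0 hi4 hE4 hK0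
  have e : ∀ X Y Z W V : Thread, ∀ F₀ F K R : Multiset Thread,
      V ::ₘ (K + F₀ + X ::ₘ Y ::ₘ Z ::ₘ W ::ₘ (F + R)) =
        Y ::ₘ Z ::ₘ W ::ₘ (F + V ::ₘ X ::ₘ (F₀ + K + R)) := by
    intros; simp only [← Multiset.singleton_add]; abel
  rw [e]
  -- The lemma expects the signals of the counter being run in front, hence the exchange of the two
  -- lists here and back again in `hi6`.
  refine sim_counter hb (hi4.perm List.perm_append_comm)
    (by rw [hE4 _ (chan_lt _ _), hv3 _ (chan_lt _ _)]; simp) ?_ ?_ ?_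
  · intro o ho hne
    rw [ne_eq, hE4 _ (chan_lt _ _), hv3 _ (chan_lt _ _)]
    simp [chan_inj, hne, hc0, hst o _ _ _ ho]
  · intro h h'
    exact hb' h (by simp [← hlen, h'])
  intro xs1 E5 K1 hl1 hi5 hE5 hK1
  have hi6 := hi5.perm List.perm_append_comm
  have hE53 : ∀ i < 13, E5 (g i) = E3 (g i) := fun i hi => (hE5 i hi).trans (hE4 i hi)
  have h0 : E5 (g 0) = some true := by rw [hE53 0 (by decide), hv3 0 (by decide)]; simp
  -- Neither the signal of `waitT` nor the observed output has been emitted: the former keeps the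
  -- waiting threads suspended, the latter is part of the conclusion.
  have hlow : ∀ i < 3, i ≠ 0 → E5 (g i) ≠ some true := by
    intro i hi hi0
    have hc : ∀ (o : Fin 5) (c : Fin 2), i ≠ chan c o := fun o c => by
      have := three_le_chan c o; omega
    rw [ne_eq, hE53 i (by omega), hv3 i (by omega)]
    simp [hi0, hc, statusChan]
  have hkill : ∀ T ∈ K0 + K1 + K, Killed g E5 T := by
    intro T hT
    simp only [Multiset.mem_add] at hT
    rcases hT with (h | h) | h
    · exact (hK0 T h).congr hE5
    · exact hK1 T h
    · exact hK3 E5 hE53 T h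
  have e : Thread.seq (waitG g) (topCall g 1 xs1) ::ₘ (K1 + frames g 1 xs1 +
        Thread.seq (waitG g) (topCall g 0 xs0) ::ₘ Thread.seq (waitG g) (ctrlCall g A') ::ₘ
          (frames g 0 xs0 + K0 + K)) =
      Thread.seq (waitG g) (ctrlCall g A') ::ₘ Thread.seq (waitG g) (topCall g 0 xs0) ::ₘ
        Thread.seq (waitG g) (topCall g 1 xs1) ::ₘ
          (frames g 0 xs0 + frames g 1 xs1 + (K0 + K1 + K)) := by
    simp only [← Multiset.singleton_add]; abel
  change Sim D (_ ::ₘ (K1 + frames g 1 xs1 +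
        _ ::ₘ Thread.seq (waitG g) (ctrlCall g A') ::ₘ _)) E5 _
  rw [e]
  refine Sim.final ?_ ⟨hlow 2 (by decide) (by decide), ![xs0, xs1],
    (K0 + K1 + K).map (Thread.floor E5), ?_, ?_, ?_, ?_, ?_⟩
  · intro T hT
    have h1 := hlow 1 (by decide) (by decide)
    simp only [Multiset.mem_cons, Multiset.mem_add (s := frames g 0 xs0 + frames g 1 xs1),
      Multiset.mem_add (s := frames g 0 xs0)] at hT
    rcases hT with rfl | rfl | rfl | (h | h) | h
    · exact suspended_wait h1
    · exact suspended_wait h1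
    · exact suspended_wait h1
    · obtain ⟨x, hx, U, rfl⟩ := mem_frames h
      have := (hi6.frame x (by simp [hx])).1
      exact suspended_await (by simp [this])
    · obtain ⟨x, hx, U, rfl⟩ := mem_frames h
      have := (hi6.frame x (by simp [hx])).1
      exact suspended_await (by simp [this])
    · exact (hkill T h).suspended
  · simp only [Multiset.map_cons, Multiset.map_add, floor_wait h0, map_floor_frames, stateP]
    rfl
  · intro c
    have : c = 0 ∨ c = 1 := by omega
    rcases this with rfl | rfl
    · simp [hl0, hlen]
    · simp [hl1, hlen]
  · intro T hT
    obtain ⟨U, hU, rfl⟩ := Multiset.mem_map.1 hT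
    exact (hkill U hU).floor h0
  · exact hi6.nodup
  · exact fun x hx => (hi6.frame x hx).2

/-- An instant in which the control thread halts. -/
theorem sim_state_halt (hD : D[0]? = some topEq) {J : Interface} (hg : Function.Injective g)
    (hgJ : ∀ i, g i ∉ J.input) {I : Set ℕ} (hI : I ⊆ J.input)
    {A : ℕ} {c : Fin 2} {z p : Act} (hA : D[A]? = some (ctrlEq c z p))
    {v : Fin 2 → ℕ} {P : Multiset Thread} (hP : IsState J g A v P)
    (hact : (if v c = 0 then z else p) = none) :
    Sim D P (startEnv J I P) fun Q E => E (g 2) = some true ∧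
      IsDead J (Q.map (Thread.floor E)) := by
  obtain ⟨xs, N, rfl, hlen, hN, hnd, hx⟩ := hP
  obtain ⟨hinv, hE⟩ := inv_start hgJ hI (A := A) (N := N) hnd hx
  refine sim_state hD hg hA hN hinv hE fun E1 K hi1 hv1 hK => ?_
  have hif : (if xs c = [] then z else p) = none := by
    rw [← hact, ← hlen c]; simp
  rw [hif]
  refine Sim.emit (.emit (g 2)) (hi1.glob 2 (by decide)) ?_
  have hi2 := hi1.emit (i := 2) (by decide)
  set E2 := Function.update E1 (g 2) (some true) with hE2
  have hv2 : ∀ i < 13, i ≠ 2 → E2 (g i) = E1 (g i) := fun i hi h =>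
    Function.update_of_ne (hg.ne h) _ _
  have hc : ∀ (o : Fin 5) (c : Fin 2), chan c o ≠ 2 ∧ chan c o ≠ 0 := fun o c => by
    have := three_le_chan c o; omega
  have h0 : E2 (g 0) = some true := by
    rw [hv2 0 (by decide) (by decide), hv1 0 (by decide)]; simp
  -- A halting control sends no command, so all six command branches are discarded.
  have hop : ∀ (c : Fin 2) (o : Fin 5), o.val < 3 → ∀ U, Killed g E2 (branchG g (chan c o) U) := by
    intro c o ho U
    refine killed_branch (chan_lt _ _) ?_ U
    rw [ne_eq, hv2 _ (chan_lt _ _) (hc _ _).1, hv1 _ (chan_lt _ _)]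
    simp only [(hc _ _).2, statusChan, chan_inj, false_or, not_or, not_and]
    constructor <;> rintro - rfl <;> split_ifs at ho <;> simp at ho
  have key : ∀ T ∈ (Thread.nil ::ₘ (keepBranch g 0 (xs 0) ::ₘ decBranch g 0 (xs 0) ::ₘ
      incBranch g 0 (xs 0) ::ₘ (frames g 0 (xs 0) + (keepBranch g 1 (xs 1) ::ₘ
      decBranch g 1 (xs 1) ::ₘ incBranch g 1 (xs 1) ::ₘ (frames g 1 (xs 1) + K))))),
      Killed g E2 T ∨ ∃ x ∈ xs 0 ++ xs 1, ∃ U, T = .seq (.await (.sig x)) U := by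
    intro T hT
    simp only [Multiset.mem_cons, Multiset.mem_add] at hT
    rcases hT with rfl | rfl | rfl | rfl | h | rfl | rfl | rfl | h | h
    · exact .inl (.inl rfl)
    · exact .inl (hop 0 2 (by decide) _)
    · exact .inl (hop 0 1 (by decide) _)
    · exact .inl (hop 0 0 (by decide) _)
    · obtain ⟨x, hx, U, rfl⟩ := mem_frames h
      exact .inr ⟨x, by simp [hx], U, rfl⟩
    · exact .inl (hop 1 2 (by decide) _)
    · exact .inl (hop 1 1 (by decide) _)
    · exact .inl (hop 1 0 (by decide) _)
    · obtain ⟨x, hx, U, rfl⟩ := mem_frames h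
      exact .inr ⟨x, by simp [hx], U, rfl⟩
    · exact .inl (hK E2 (fun c o ho => hv2 _ (chan_lt _ _) (hc _ _).1) T h)
  refine Sim.final ?_ ⟨by simp [hE2], ?_⟩
  · intro T hT
    rcases key T hT with h | ⟨x, hx, U, rfl⟩
    · exact h.suspended
    · have := (hi2.frame x hx).1
      exact suspended_await (by simp [this])
  · intro T hT
    obtain ⟨U, hU, rfl⟩ := Multiset.mem_map.1 hT
    rcases key U hU with h | ⟨x, hx, U, rfl⟩
    · exact .inl (h.floor h0)
    · exact .inr ⟨x, (hi2.frame x hx).2.1, U, by simp [Thread.floor]⟩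

/-- The remaining frames await signals that are not inputs, and no thread is left that could emit
them. -/
theorem sim_dead {J : Interface} {I : Set ℕ} (hI : I ⊆ J.input) {P : Multiset Thread}
    (hP : IsDead J P) :
    Sim D P (startEnv J I P) fun Q E => IsDead J (Q.map (Thread.floor E)) := by
  refine Sim.final ?_ ?_
  · intro T hT
    rcases hP T hT with rfl | ⟨x, hx, U, rfl⟩
    · exact suspended_nil
    · exact suspended_await (startEnv_ne_true hI hx)
  · intro T hT
    obtain ⟨U, hU, rfl⟩ := Multiset.mem_map.1 hT
    rcases hP U hU with rfl | ⟨x, hx, U, rfl⟩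
    · exact .inl rfl
    · exact .inr ⟨x, hx, U, by simp [Thread.floor]⟩

end Semantics
end SL

namespace CounterMachine

/-! ### Machines with empty initial counters -/

/-- The computation from `k` is finite. -/
def Machine.HaltsFrom (M : Machine) (k : Config) : Prop :=
  ∃ k', Relation.ReflTransGen (fun k k' => M.next k = some k') k k' ∧ M.next k' = none

theorem Machine.haltsFrom_congr {M : Machine} {k k' : Config} (h : M.next k = some k') :
    M.HaltsFrom k ↔ M.HaltsFrom k' := by
  constructor
  · rintro ⟨l, hl, hn⟩
    rcases Relation.ReflTransGen.cases_head hl with rfl | ⟨k₁, h1, h2⟩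
    · simp [h] at hn
    · rw [h] at h1
      cases h1
      exact ⟨l, h2, hn⟩
  · rintro ⟨l, hl, hn⟩
    exact ⟨l, .head h hl, hn⟩

theorem Machine.haltsFrom_congr_of_reaches {M : Machine} {k k' : Config}
    (h : Relation.ReflTransGen (fun k k' => M.next k = some k') k k') :
    M.HaltsFrom k ↔ M.HaltsFrom k' := by
  induction h with
  | refl => rfl
  | tail _ h ih => exact ih.trans (Machine.haltsFrom_congr h)

def Instr.shift (n : ℕ) : Instr → Instr
  | .inc c q => .inc c (q + n)
  | .dec c q => .dec c (q + n)
  | .test c q q' => .test c (q + n) (q' + n)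

def Config.shift (n : ℕ) (k : Config) : Config := ⟨k.state + n, k.cnt⟩

theorem Instr.exec_shift (n : ℕ) (i : Instr) (v : Fin 2 → ℕ) :
    (i.shift n).exec v = (i.exec v).map (Config.shift n) := by
  cases i <;> simp only [shift, exec] <;> try split_ifs
  all_goals rfl

/-- Instructions that fill the counters of `M`. -/
def Machine.fillCode (M : Machine) : List Instr :=
  (List.range (M.init 0)).map (fun j => .inc 0 (j + 1)) ++
    (List.range (M.init 1)).map (fun j => .inc 1 (M.init 0 + j + 1))

/-- A machine that starts with empty counters and simulates `M`. -/
def Machine.zeroInit (M : Machine) : Machine :=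
  ⟨M.fillCode ++ (.test 0 (M.start + (M.fillCode.length + 1)) (M.start + (M.fillCode.length + 1)) ::
    M.code.map (Instr.shift (M.fillCode.length + 1))), 0, fun _ => 0⟩

theorem Machine.length_fillCode (M : Machine) : M.fillCode.length = M.init 0 + M.init 1 := by
  simp [fillCode]

/-- The code of `M` stands behind the filling code and one jump. States outside the code of `M` stay
outside, so stuck configurations correspond as well. -/
theorem Machine.zeroInit_next_shift (M : Machine) (k : Config) :
    M.zeroInit.next (k.shift (M.fillCode.length + 1)) =
      (M.next k).map (Config.shift (M.fillCode.length + 1)) := by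
  have h : M.zeroInit.code[k.state + (M.fillCode.length + 1)]? =
      M.code[k.state]?.map (Instr.shift (M.fillCode.length + 1)) := by
    rw [zeroInit, List.getElem?_append_right (by omega)]
    have : k.state + (M.fillCode.length + 1) - M.fillCode.length = k.state + 1 := by omega
    rw [this]
    simp
  simp only [next, Config.shift, h]
  cases M.code[k.state]? with
  | none => rfl
  | some i => exact Instr.exec_shift _ _ _

theorem Machine.zeroInit_haltsFrom_shift (M : Machine) (k : Config) :
    M.zeroInit.HaltsFrom (k.shift (M.fillCode.length + 1)) ↔ M.HaltsFrom k := by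
  constructor
  · rintro ⟨l, hl, hn⟩
    generalize hk : k.shift (M.fillCode.length + 1) = k₁ at hl
    induction hl using Relation.ReflTransGen.head_induction_on generalizing k with
    | refl =>
      subst hk
      rw [zeroInit_next_shift, Option.map_eq_none_iff] at hn
      exact ⟨k, .refl, hn⟩
    | head h _ ih =>
      subst hk
      rw [zeroInit_next_shift, Option.map_eq_some_iff] at h
      obtain ⟨k', h1, h2⟩ := h
      exact (haltsFrom_congr h1).2 (ih k' h2)
  · rintro ⟨l, hl, hn⟩
    induction hl using Relation.ReflTransGen.head_induction_on with
    | refl => exact ⟨_, .refl, by rw [zeroInit_next_shift, hn]; rfl⟩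
    | head h _ ih =>
      exact (haltsFrom_congr (by rw [zeroInit_next_shift, h]; rfl)).2 ih

/-- During the filling phase the state number equals the number of increments performed, first on
counter 0 and then on counter 1. -/
theorem Machine.zeroInit_reaches (M : Machine) :
    Relation.ReflTransGen (fun k k' => M.zeroInit.next k = some k') M.zeroInit.initial
      (M.initial.shift (M.fillCode.length + 1)) := by
  have hcode : ∀ j (hj : j < M.fillCode.length), M.zeroInit.code[j]? = some M.fillCode[j] := by
    intro j hj
    rw [zeroInit, List.getElem?_append_left hj, List.getElem?_eq_getElem hj]
  have h0 : ∀ j ≤ M.init 0, Relation.ReflTransGen (fun k k' => M.zeroInit.next k = some k')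
      M.zeroInit.initial ⟨j, ![j, 0]⟩ := by
    intro j
    induction j with
    | zero =>
      intro _
      have : M.zeroInit.initial = ⟨0, ![0, 0]⟩ := by
        simp only [initial, zeroInit, Config.mk.injEq, true_and]
        ext i; fin_cases i <;> rfl
      rw [this]
    | succ j ih =>
      intro hj
      refine (ih (by omega)).tail ?_
      have hl : j < M.fillCode.length := by rw [length_fillCode]; omega
      have : M.fillCode[j] = .inc 0 (j + 1) := by
        simp only [fillCode]
        rw [List.getElem_append_left (by simpa using hj)]
        simp
      simp only [next, hcode j hl, this, Instr.exec]
      congr 2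
      ext i; fin_cases i <;> simp
  have h1 : ∀ j ≤ M.init 1, Relation.ReflTransGen (fun k k' => M.zeroInit.next k = some k')
      M.zeroInit.initial ⟨M.init 0 + j, ![M.init 0, j]⟩ := by
    intro j
    induction j with
    | zero => exact fun _ => h0 _ le_rfl
    | succ j ih =>
      intro hj
      refine (ih (by omega)).tail ?_
      have hl : M.init 0 + j < M.fillCode.length := by rw [length_fillCode]; omega
      have : M.fillCode[M.init 0 + j] = .inc 1 (M.init 0 + j + 1) := by
        simp only [fillCode]
        rw [List.getElem_append_right (by simp)]
        simp
      simp only [next, hcode _ hl, this, Instr.exec]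
      congr 2
      ext i; fin_cases i <;> simp
  refine (h1 _ le_rfl).tail ?_
  -- A `test` with equal targets serves as an unconditional jump to the shifted start state.
  have : M.zeroInit.code[M.init 0 + M.init 1]? = some (.test 0
      (M.start + (M.fillCode.length + 1)) (M.start + (M.fillCode.length + 1))) := by
    rw [← length_fillCode, zeroInit, List.getElem?_append_right le_rfl]
    simp
  simp only [next, this, Instr.exec, ite_self, initial, Config.shift]
  congr 2
  ext i; fin_cases i <;> rfl

theorem Machine.zeroInit_terminates (M : Machine) : M.zeroInit.Terminates ↔ M.Terminates :=
  (haltsFrom_congr_of_reaches M.zeroInit_reaches).trans (M.zeroInit_haltsFrom_shift M.initial)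

end CounterMachine

namespace SL

open CounterMachine

/-! ### The program of a machine -/

/-- The identifier of the state `q` of a machine with `n` instructions. -/
def stateId (n q : ℕ) : ℕ := if q < n then q + 2 else 1

/-- The counter that is not concerned receives the command 2, to keep its content. -/
def commands (c : Fin 2) (o : Fin 5) : Fin 5 × Fin 5 := if c = 0 then (o, 2) else (2, o)

/-- An increment ignores the answer, both actions being equal. The inapplicable decrement of a zero
counter is the action `none`, which halts. -/
def instrEq (n : ℕ) : Instr → Equation
  | .inc c q => ctrlEq c (some (commands c 0, stateId n q)) (some (commands c 0, stateId n q))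
  | .dec c q => ctrlEq c none (some (commands c 1, stateId n q))
  | .test c q q' => ctrlEq c (some ((2, 2), stateId n q)) (some ((2, 2), stateId n q'))

/-- Identifier 0 is the top of a counter. Identifier 1 halts on either answer and serves all states
without instruction, which is why instructions start at 2 in `stateId`. -/
def machineEqs (code : List Instr) : List Equation :=
  topEq :: ctrlEq 0 none none :: code.map (instrEq code.length)

def machineProgram (g : ℕ → ℕ) (M : Machine) : Program :=
  ⟨machineEqs M.code, [.seq .nil (ctrlCall g (stateId M.code.length M.start)),
    .seq .nil (topCall g 0 []), .seq .nil (topCall g 1 [])]⟩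

theorem machineEqs_stateId (code : List Instr) (q : ℕ) :
    (machineEqs code)[stateId code.length q]? =
      some ((code[q]?.map (instrEq code.length)).getD (ctrlEq 0 none none)) := by
  unfold stateId machineEqs
  split_ifs with h
  · simp [h]
  · have : code[q]? = none := List.getElem?_eq_none (not_lt.1 h)
    simp [this]

theorem instrEq_arity (n : ℕ) (i : Instr) : (instrEq n i).arity = 13 := by
  cases i <;> rfl

theorem exists_machineEqs_stateId (code : List Instr) (q : ℕ) :
    ∃ e, (machineEqs code)[stateId code.length q]? = some e ∧ e.arity = 13 := by
  refine ⟨_, machineEqs_stateId code q, ?_⟩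
  cases code[q]? with
  | none => rfl
  | some i => exact instrEq_arity _ i

theorem ctrlEq_wf {D : List Equation} {c : Fin 2} {z p : Act}
    (h : ∀ a ∈ [z, p], ∀ b A, a = some (b, A) → ∃ e, D[A]? = some e ∧ e.arity = 13) :
    (ctrlEq c z p).body.WF D (ctrlEq c z p).arity ∧ (ctrlEq c z p).body.sigs = ∅ := by
  have key : ∀ a ∈ [z, p], (actT .var a).WF D 13 ∧ (actT .var a).sigs = ∅ := by
    intro a ha
    rcases a with _ | ⟨⟨b, b'⟩, A⟩
    · simp [actT, Thread.WF, Name.Closed, Thread.sigs, Name.sigs]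
    · obtain ⟨e, he, hA⟩ := h _ ha _ _ rfl
      simp [actT, waitT, Thread.WF, Name.Closed, Thread.sigs, Name.sigs, chan_lt, he, hA]
  have hz := key z (by simp)
  have hp := key p (by simp)
  simp [ctrlEq, ctrlT, branchT, Thread.WF, Name.Closed, Thread.sigs, Name.sigs, chan_lt, hz, hp]

theorem machineProgram_wf (g : ℕ → ℕ) (M : Machine) : (machineProgram g M).WF := by
  refine ⟨by simp [machineProgram], ?_, ?_⟩
  · intro T hT
    simp only [machineProgram, List.mem_cons, List.not_mem_nil, or_false] at hT
    rcases hT with rfl | rfl | rfl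
    · obtain ⟨e, he, hA⟩ := exists_machineEqs_stateId M.code M.start
      refine ⟨trivial, ⟨e, he, by simp [hA]⟩, ?_⟩
      simp [sigG, Name.Closed]
    · exact ⟨trivial, ⟨topEq, rfl, rfl⟩, by simp [Name.Closed]⟩
    · exact ⟨trivial, ⟨topEq, rfl, rfl⟩, by simp [Name.Closed]⟩
  · intro e he
    have hid := exists_machineEqs_stateId M.code
    simp only [machineProgram, machineEqs, List.mem_cons, List.mem_map] at he
    rcases he with rfl | rfl | ⟨i, -, rfl⟩
    · constructor
      · simp [machineProgram, machineEqs, topEq, topT, pushT, branchT, waitT, Thread.WF,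
          Name.Closed]
      · simp [topEq, topT, pushT, branchT, waitT, Thread.sigs, Name.sigs]
    · exact ctrlEq_wf (by simp)
    · cases i with
      | inc c q =>
        refine ctrlEq_wf fun a ha b A h => ?_
        simp only [List.mem_cons, List.not_mem_nil, or_false, or_self] at ha
        subst ha
        cases h
        exact hid q
      | dec c q =>
        refine ctrlEq_wf fun a ha b A h => ?_
        simp only [List.mem_cons, List.not_mem_nil, or_false] at ha
        rcases ha with rfl | rfl <;> cases h
        exact hid q
      | test c q q' =>
        refine ctrlEq_wf fun a ha b A h => ?_
        simp only [List.mem_cons, List.not_mem_nil, or_false] at ha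
        rcases ha with rfl | rfl <;> cases h
        · exact hid q
        · exact hid q'

/-! ### Runs of the program compared with the computation of the machine -/

section Correctness

variable {J : Interface} {g : ℕ → ℕ} {M : Machine}

/-- The programs that represent the configuration `k` of `M`. -/
def Represents (J : Interface) (g : ℕ → ℕ) (M : Machine) (k : Config) (P : Multiset Thread) :
    Prop :=
  IsState J g (stateId M.code.length k.state) k.cnt P

theorem represents_initial (h : M.init = fun _ => 0) :
    Represents J g M M.initial ((machineProgram g M).threads : Multiset Thread) := by
  refine ⟨fun _ => [], 0, ?_, ?_, by simp, by simp, by simp⟩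
  · simp [stateP, machineProgram, frames, Machine.initial]
    rfl
  · simp [Machine.initial, h]

theorem instants_step (hg : Function.Injective g) (hgJ : ∀ i, g i ∉ J.input) {k k' : Config}
    (hk : M.next k = some k') {P : Multiset Thread} (hP : Represents J g M k P) {I : Set ℕ}
    (hI : I ⊆ J.input) :
    (∃ O P', Instant J (machineEqs M.code) P I O P') ∧
      ∀ O P', Instant J (machineEqs M.code) P I O P' → g 2 ∉ O ∧ Represents J g M k' P' := by
  have hD : (machineEqs M.code)[0]? = some topEq := rfl
  have hA := machineEqs_stateId M.code k.state
  -- For each instruction it remains to compare the selected action and its effect on both counters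
  -- with the machine step.
  have main : ∀ {c : Fin 2} {z p : Act} {a b : Fin 5} {q : ℕ},
      (machineEqs M.code)[stateId M.code.length k.state]? = some (ctrlEq c z p) →
      (if k.cnt c = 0 then z else p) = some ((a, b), stateId M.code.length q) →
      a.val < 3 → b.val < 3 → (a = 1 → k.cnt 0 ≠ 0) → (b = 1 → k.cnt 1 ≠ 0) →
      k' = ⟨q, ![opEffect a (k.cnt 0), opEffect b (k.cnt 1)]⟩ →
      (∃ O P', Instant J (machineEqs M.code) P I O P') ∧
        ∀ O P', Instant J (machineEqs M.code) P I O P' → g 2 ∉ O ∧ Represents J g M k' P' := by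
    rintro c z p a b q h1 h2 h3 h4 h5 h6 rfl
    have := sim_state_go hD hg hgJ hI h1 hP h2 h3 h4 h5 h6
    refine Sim.instants hI (K := fun O P' => g 2 ∉ O ∧ Represents J g M _ P')
      ⟨this.1, fun d hd hF => ?_⟩
    obtain ⟨h7, h8⟩ := this.2 d hd hF
    exact ⟨fun h => h7 h.2, h8⟩
  unfold Machine.next at hk
  cases hc : M.code[k.state]? with
  | none => simp [hc] at hk
  | some i =>
    rw [hc] at hA hk
    have h2 : ∀ c : Fin 2, c = 0 ∨ c = 1 := by decide
    cases i with
    | inc c q =>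
      simp only [Instr.exec, Option.some.injEq] at hk
      rcases h2 c with rfl | rfl
      · refine main (a := 0) (b := 2) (q := q) hA (by simp [commands]) (by decide) (by decide)
          (by simp) (by simp) ?_
        rw [← hk]; congr 1; ext i; fin_cases i <;> simp [opEffect]
      · refine main (a := 2) (b := 0) (q := q) hA (by simp [commands]) (by decide) (by decide)
          (by simp) (by simp) ?_
        rw [← hk]; congr 1; ext i; fin_cases i <;> simp [opEffect]
    | dec c q =>
      simp only [Instr.exec] at hk
      split_ifs at hk with h0
      simp only [Option.some.injEq] at hk
      rcases h2 c with rfl | rfl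
      · refine main (a := 1) (b := 2) (q := q) hA (by simp [commands, h0]) (by decide) (by decide)
          (by simp [h0]) (by simp) ?_
        rw [← hk]; congr 1; ext i; fin_cases i <;> simp [opEffect]
      · refine main (a := 2) (b := 1) (q := q) hA (by simp [commands, h0]) (by decide) (by decide)
          (by simp) (by simp [h0]) ?_
        rw [← hk]; congr 1; ext i; fin_cases i <;> simp [opEffect]
    | test c q q' =>
      simp only [Instr.exec, Option.some.injEq] at hk
      refine main (a := 2) (b := 2) (q := if k.cnt c = 0 then q else q') hA
        (by split_ifs <;> rfl) (by decide) (by decide) (by simp) (by simp) ?_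
      rw [← hk]; congr 1; ext i; fin_cases i <;> simp [opEffect]

theorem instants_halt (hg : Function.Injective g) (hgJ : ∀ i, g i ∉ J.input)
    (hout : g 2 ∈ J.output) {k : Config}
    (hk : M.next k = none) {P : Multiset Thread} (hP : Represents J g M k P) {I : Set ℕ}
    (hI : I ⊆ J.input) :
    (∃ O P', Instant J (machineEqs M.code) P I O P') ∧
      ∀ O P', Instant J (machineEqs M.code) P I O P' → g 2 ∈ O ∧ IsDead J P' := by
  have hD : (machineEqs M.code)[0]? = some topEq := rfl
  have hA := machineEqs_stateId M.code k.state
  have main : ∀ {c : Fin 2} {z p : Act},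
      (machineEqs M.code)[stateId M.code.length k.state]? = some (ctrlEq c z p) →
      (if k.cnt c = 0 then z else p) = none →
      (∃ O P', Instant J (machineEqs M.code) P I O P') ∧
        ∀ O P', Instant J (machineEqs M.code) P I O P' → g 2 ∈ O ∧ IsDead J P' := by
    intro c z p h1 h2
    have := sim_state_halt hD hg hgJ hI h1 hP h2
    refine Sim.instants hI (K := fun O P' => g 2 ∈ O ∧ IsDead J P')
      ⟨this.1, fun d hd hF => ?_⟩
    obtain ⟨h7, h8⟩ := this.2 d hd hF
    exact ⟨⟨hout, h7⟩, h8⟩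
  unfold Machine.next at hk
  cases hc : M.code[k.state]? with
  | none =>
    rw [hc] at hA
    exact main hA (by simp)
  | some i =>
    rw [hc] at hA hk
    cases i with
    | inc c q => simp [Instr.exec] at hk
    | dec c q =>
      simp only [Instr.exec] at hk
      split_ifs at hk with h0
      exact main hA (by simp [h0])
    | test c q q' => simp [Instr.exec] at hk

theorem instants_dead {D : List Equation} {P : Multiset Thread} (hP : IsDead J P) {I : Set ℕ}
    (hI : I ⊆ J.input) :
    (∃ O P', Instant J D P I O P') ∧ ∀ O P', Instant J D P I O P' → IsDead J P' :=
  Sim.instants hI (sim_dead hI hP)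

/-- The programs that occur in runs of the program of `M`. -/
def Live (J : Interface) (g : ℕ → ℕ) (M : Machine) (P : Multiset Thread) : Prop :=
  (∃ k, Represents J g M k P) ∨ IsDead J P

theorem Live.instants (hg : Function.Injective g) (hgJ : ∀ i, g i ∉ J.input)
    (hout : g 2 ∈ J.output) {P : Multiset Thread} (hP : Live J g M P) {I : Set ℕ}
    (hI : I ⊆ J.input) :
    (∃ O P', Instant J (machineEqs M.code) P I O P') ∧
      ∀ O P', Instant J (machineEqs M.code) P I O P' → Live J g M P' := by
  rcases hP with ⟨k, hk⟩ | hd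
  · cases hn : M.next k with
    | none =>
      have := instants_halt hg hgJ hout hn hk hI
      exact ⟨this.1, fun O P' h => .inr (this.2 O P' h).2⟩
    | some k' =>
      have := instants_step hg hgJ hn hk hI
      exact ⟨this.1, fun O P' h => .inl ⟨k', (this.2 O P' h).2⟩⟩
  · have := instants_dead (D := machineEqs M.code) hd hI
    exact ⟨this.1, fun O P' h => .inr (this.2 O P' h)⟩

theorem Live.reactive (hg : Function.Injective g) (hgJ : ∀ i, g i ∉ J.input)
    (hout : g 2 ∈ J.output) {P : Multiset Thread} (hP : Live J g M P) :
    Reactive J (machineEqs M.code) P := by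
  refine ⟨{P | Live J g M P}, hP, fun Q hQ I hI => ?_⟩
  obtain ⟨⟨O, P', h⟩, h'⟩ := Live.instants hg hgJ hout hQ hI
  exact ⟨O, P', h, h' O P' h⟩

theorem Live.run (hg : Function.Injective g) (hgJ : ∀ i, g i ∉ J.input)
    (hout : g 2 ∈ J.output) {P P' : Multiset Thread} {w : List (Set ℕ × Set ℕ)}
    (h : Run J (machineEqs M.code) P w P') (hP : Live J g M P) : Live J g M P' := by
  induction h with
  | nil P => exact hP
  | cons P P' P'' I O w h _ ih => exact ih ((Live.instants hg hgJ hout hP h.1).2 _ _ h)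

/-- As long as the machine has a successor, the instant does not emit and the emission lies in the
rest of the run. As the run is finite, a stuck configuration must be met. -/
theorem haltsFrom_of_run (hg : Function.Injective g) (hgJ : ∀ i, g i ∉ J.input)
    {P P' : Multiset Thread} {w : List (Set ℕ × Set ℕ)}
    (h : Run J (machineEqs M.code) P w P') (hw : ∃ io ∈ w, g 2 ∈ io.2) {k : Config}
    (hP : Represents J g M k P) : M.HaltsFrom k := by
  induction h generalizing k with
  | nil P => simp at hw
  | cons P P' P'' I O w h _ ih =>
    cases hn : M.next k with
    | none => exact ⟨k, .refl, hn⟩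
    | some k' =>
      obtain ⟨h1, h2⟩ := (instants_step hg hgJ hn hP h.1).2 _ _ h
      refine (Machine.haltsFrom_congr hn).2 (ih ?_ h2)
      simpa [h1] using hw

theorem emits_of_haltsFrom (hg : Function.Injective g) (hgJ : ∀ i, g i ∉ J.input)
    (hout : g 2 ∈ J.output) {k : Config} (hk : M.HaltsFrom k) {Q : ℕ → Multiset Thread}
    {I O : ℕ → Set ℕ} (hQ : Represents J g M k (Q 0))
    (h : ∀ n, Instant J (machineEqs M.code) (Q n) (I n) (O n) (Q (n + 1))) :
    ∃ n, g 2 ∈ O n := by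
  obtain ⟨l, hl, hn⟩ := hk
  induction hl using Relation.ReflTransGen.head_induction_on generalizing Q I O with
  | refl => exact ⟨0, ((instants_halt hg hgJ hout hn hQ (h 0).1).2 _ _ (h 0)).1⟩
  | head h1 _ ih =>
    obtain ⟨n, hn⟩ := ih (Q := fun n => Q (n + 1)) (I := fun n => I (n + 1))
      (O := fun n => O (n + 1)) ((instants_step hg hgJ h1 hQ (h 0).1).2 _ _ (h 0)).2
      fun n => h (n + 1)
    exact ⟨n + 1, hn⟩

theorem run_of_instants {D : List Equation} {Q : ℕ → Multiset Thread} {I O : ℕ → Set ℕ}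
    (h : ∀ n, Instant J D (Q n) (I n) (O n) (Q (n + 1))) (n : ℕ) :
    ∃ w, Run J D (Q 0) w (Q (n + 1)) ∧ (I n, O n) ∈ w := by
  induction n generalizing Q I O with
  | zero => exact ⟨[(I 0, O 0)], .cons _ _ _ _ _ _ (h 0) (.nil _), by simp⟩
  | succ n ih =>
    obtain ⟨w, h1, h2⟩ := ih (Q := fun n => Q (n + 1)) (I := fun n => I (n + 1))
      (O := fun n => O (n + 1)) fun n => h (n + 1)
    exact ⟨_, .cons _ _ _ _ _ _ (h 0) h1, List.mem_cons_of_mem _ h2⟩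

/-- Reactivity supplies an infinite run with empty inputs. That run is complete, hence emits, and a
finite prefix of it witnesses the possible emission. -/
theorem MustEmit.mayEmit {D : List Equation} {P : Multiset Thread} {s : ℕ}
    (h : MustEmit J D P s) (hP : Reactive J D P) : MayEmit J D P s := by
  obtain ⟨R, hPR, hR⟩ := hP
  choose O P' h1 h2 using fun Q : R => hR Q.1 Q.2 ∅ (Set.empty_subset _)
  let f : R → R := fun Q => ⟨P' Q, h2 Q⟩
  let Q : ℕ → R := fun n => f^[n] ⟨P, hPR⟩
  have hQ : ∀ n, Instant J D (Q n).1 ∅ (O (Q n)) (Q (n + 1)).1 := by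
    intro n
    have : Q (n + 1) = f (Q n) := Function.iterate_succ_apply' f n _
    rw [this]
    exact h1 (Q n)
  obtain ⟨n, hn⟩ := h.1 (fun n => (Q n).1) (fun _ => ∅) (fun n => O (Q n)) rfl hQ
  obtain ⟨w, hw, hm⟩ := run_of_instants hQ n
  exact ⟨w, _, hw, _, hm, hn⟩

theorem machineProgram_correct (hg : Function.Injective g) (hgJ : ∀ i, g i ∉ J.input)
    (hout : g 2 ∈ J.output) (hM : M.init = fun _ => 0) :
    Reactive J (machineProgram g M).eqs ((machineProgram g M).threads : Multiset Thread) ∧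
    (MustEmit J (machineProgram g M).eqs ((machineProgram g M).threads : Multiset Thread) (g 2) ↔
      M.Terminates) ∧
    (MayEmit J (machineProgram g M).eqs ((machineProgram g M).threads : Multiset Thread) (g 2) ↔
      M.Terminates) := by
  have hinit := represents_initial (J := J) (g := g) hM
  have hlive : Live J g M ((machineProgram g M).threads : Multiset Thread) := .inl ⟨_, hinit⟩
  have hre := hlive.reactive hg hgJ hout
  have hmay : MayEmit J (machineProgram g M).eqs
      ((machineProgram g M).threads : Multiset Thread) (g 2) → M.Terminates :=
    fun ⟨w, P', h, hw⟩ => haltsFrom_of_run hg hgJ h hw hinit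
  have hmust : M.Terminates → MustEmit J (machineProgram g M).eqs
      ((machineProgram g M).threads : Multiset Thread) (g 2) := by
    refine fun ht => ⟨fun Q I O h0 h => emits_of_haltsFrom hg hgJ hout ht (h0 ▸ hinit) h, ?_⟩
    -- No finite run is complete: its last program is still `Live` and has a further instant.
    intro w P' h hno
    obtain ⟨⟨O, P'', h'⟩, -⟩ :=
      (hlive.run hg hgJ hout h).instants hg hgJ hout (Set.empty_subset _)
    exact absurd h' (hno _ _ _)
  exact ⟨hre, ⟨fun h => hmay (h.mayEmit hre), hmust⟩, ⟨hmay, fun h => (hmust h).mayEmit hre⟩⟩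

end Correctness

end SL

namespace SL

open CounterMachine

/-! ### Computability of the encoding -/

section Primrec

variable {α : Type*} [Primcodable α]

/-- Gödel numbers are arithmetic expressions in the numbers of the parts, so primitive recursiveness
can be checked on codes. -/
theorem primrec_seq {f h : α → Thread} (hf : Primrec f) (hh : Primrec h) :
    Primrec fun a => Thread.seq (f a) (h a) := by
  refine Primrec.encode_iff.1 ?_
  change Primrec fun a => 7 * Nat.pair (Encodable.encode (f a)) (Encodable.encode (h a)) + 1
  exact Primrec.succ.comp (Primrec.nat_mul.comp (Primrec.const 7)
    (Primrec₂.natPair.comp (Primrec.encode.comp hf) (Primrec.encode.comp hh)))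

theorem primrec_thread {f : α → Thread} (hf : Primrec f) : Primrec fun a => Thread.thread (f a) := by
  refine Primrec.encode_iff.1 ?_
  change Primrec fun a => 7 * Encodable.encode (f a) + 4
  exact Primrec.nat_add.comp (Primrec.nat_mul.comp (Primrec.const 7) (Primrec.encode.comp hf))
    (Primrec.const 4)

theorem primrec_watch (x : Name) {f : α → Thread} (hf : Primrec f) :
    Primrec fun a => Thread.watch x (f a) := by
  refine Primrec.encode_iff.1 ?_
  change Primrec fun a => 7 * Nat.pair (Encodable.encode x) (Encodable.encode (f a)) + 6
  exact Primrec.nat_add.comp (Primrec.nat_mul.comp (Primrec.const 7)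
    (Primrec₂.natPair.comp (Primrec.const _) (Primrec.encode.comp hf))) (Primrec.const 6)

theorem primrec_call (xs : List Name) {f : α → ℕ} (hf : Primrec f) :
    Primrec fun a => Thread.call (f a) xs := by
  refine Primrec.encode_iff.1 ?_
  change Primrec fun a => 7 * Nat.pair (f a) (Encodable.encode xs) + 7
  exact Primrec.nat_add.comp (Primrec.nat_mul.comp (Primrec.const 7)
    (Primrec₂.natPair.comp hf (Primrec.const _))) (Primrec.const 7)

theorem primrec_equation (n : ℕ) {f : α → Thread} (hf : Primrec f) :
    Primrec fun a => Equation.mk n (f a) :=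
  (Primrec.of_equiv_symm (e := Equation.equivProd)).comp ((Primrec.const n).pair hf)

theorem primrec_program {f : α → List Equation} {h : α → List Thread} (hf : Primrec f)
    (hh : Primrec h) : Primrec fun a => Program.mk (f a) (h a) :=
  (Primrec.of_equiv_symm (e := Program.equivProd)).comp (hf.pair hh)

theorem primrec_actT (nm : ℕ → Name) : Primrec (actT nm) := by
  have h : Primrec fun x : (Fin 5 × Fin 5) × ℕ => actT nm (some x) := by
    refine primrec_seq ((Primrec.dom_finite fun o : Fin 5 => Thread.emit (nm (chan 0 o))).comp
      (Primrec.fst.comp Primrec.fst)) (primrec_seq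
      ((Primrec.dom_finite fun o : Fin 5 => Thread.emit (nm (chan 1 o))).comp
      (Primrec.snd.comp Primrec.fst)) (primrec_seq (Primrec.const _) (primrec_call _ Primrec.snd)))
  refine (Primrec.option_casesOn Primrec.id (Primrec.const (actT nm none))
    (h.comp Primrec.snd).to₂).of_eq fun a => ?_
  cases a <;> rfl

/-- The names that vary depend only on a counter or an offset, that is, on an argument from a finite
type; functions on such a type are primitive recursive. -/
theorem primrec_ctrlEq {c : α → Fin 2} {z p : α → Act} (hc : Primrec c) (hz : Primrec z)
    (hp : Primrec p) : Primrec fun a => ctrlEq (c a) (z a) (p a) := by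
  have hw : ∀ (o : Fin 5) {f : α → Act}, Primrec f → Primrec fun a =>
      branchT (.var 0) (.var (chan (c a) o)) (.thread (actT .var (f a))) := fun o f hf =>
    primrec_watch _ (primrec_seq
      ((Primrec.dom_finite fun c : Fin 2 => Thread.await (.var (chan c o))).comp hc)
      (primrec_thread ((primrec_actT _).comp hf)))
  exact primrec_equation 13 (primrec_seq (Primrec.const _)
    (primrec_seq (primrec_thread (hw 3 hz)) (hw 4 hp)))

theorem primrec_stateId {n q : α → ℕ} (hn : Primrec n) (hq : Primrec q) :
    Primrec fun a => stateId (n a) (q a) :=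
  Primrec.ite (Primrec.nat_lt.comp hq hn) (Primrec.nat_add.comp hq (Primrec.const 2))
    (Primrec.const 1)

theorem primrec_instr_casesOn {σ : Type*} [Primcodable σ] {f : α → Instr}
    {hi hd : α → Fin 2 × ℕ → σ} {ht : α → Fin 2 × ℕ × ℕ → σ} (hf : Primrec f)
    (h1 : Primrec₂ hi) (h2 : Primrec₂ hd) (h3 : Primrec₂ ht) :
    Primrec fun a => (match f a with
      | .inc c q => hi a (c, q)
      | .dec c q => hd a (c, q)
      | .test c q q' => ht a (c, q, q') : σ) := by
  refine (Primrec.sumCasesOn ((Primrec.of_equiv (e := Instr.equivSum)).comp hf) h1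
    (Primrec.sumCasesOn (α := α × ((Fin 2 × ℕ) ⊕ (Fin 2 × ℕ × ℕ))) Primrec.snd
      (g := fun x => hd x.1) (h := fun x => ht x.1)
      (h2.comp (Primrec.fst.comp Primrec.fst) Primrec.snd).to₂
      (h3.comp (Primrec.fst.comp Primrec.fst) Primrec.snd).to₂).to₂).of_eq fun a => ?_
  cases f a <;> rfl

theorem primrec_instrEq {n : α → ℕ} {f : α → Instr} (hn : Primrec n) (hf : Primrec f) :
    Primrec fun a => instrEq (n a) (f a) := by
  have hcmd : ∀ o : Fin 5, Primrec fun c : Fin 2 => commands c o := fun o => Primrec.dom_finite _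
  have hinc : Primrec₂ fun (a : α) (x : Fin 2 × ℕ) => ctrlEq x.1
      (some (commands x.1 0, stateId (n a) x.2)) (some (commands x.1 0, stateId (n a) x.2)) := by
    have h : Primrec fun y : α × Fin 2 × ℕ =>
        (some (commands y.2.1 0, stateId (n y.1) y.2.2) : Act) :=
      Primrec.option_some.comp (((hcmd 0).comp (Primrec.fst.comp Primrec.snd)).pair
        (primrec_stateId (hn.comp Primrec.fst) (Primrec.snd.comp Primrec.snd)))
    exact primrec_ctrlEq (Primrec.fst.comp Primrec.snd) h h
  have hdec : Primrec₂ fun (a : α) (x : Fin 2 × ℕ) => ctrlEq x.1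
      none (some (commands x.1 1, stateId (n a) x.2)) :=
    primrec_ctrlEq (Primrec.fst.comp Primrec.snd) (Primrec.const _)
      (Primrec.option_some.comp (((hcmd 1).comp (Primrec.fst.comp Primrec.snd)).pair
        (primrec_stateId (hn.comp Primrec.fst) (Primrec.snd.comp Primrec.snd))))
  have htest : Primrec₂ fun (a : α) (x : Fin 2 × ℕ × ℕ) => ctrlEq x.1
      (some ((2, 2), stateId (n a) x.2.1)) (some ((2, 2), stateId (n a) x.2.2)) :=
    primrec_ctrlEq (Primrec.fst.comp Primrec.snd)
      (Primrec.option_some.comp ((Primrec.const (2, 2)).pair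
        (primrec_stateId (hn.comp Primrec.fst) (Primrec.fst.comp (Primrec.snd.comp Primrec.snd)))))
      (Primrec.option_some.comp ((Primrec.const (2, 2)).pair
        (primrec_stateId (hn.comp Primrec.fst) (Primrec.snd.comp (Primrec.snd.comp Primrec.snd)))))
  refine (primrec_instr_casesOn hf hinc hdec htest).of_eq fun a => ?_
  cases f a <;> rfl

theorem primrec_instr_shift {n : α → ℕ} {f : α → Instr} (hn : Primrec n) (hf : Primrec f) :
    Primrec fun a => (f a).shift (n a) := by
  have hs : Primrec Instr.equivSum.symm := Primrec.of_equiv_symm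
  have hq : Primrec fun y : α × Fin 2 × ℕ => (y.2.1, y.2.2 + n y.1) :=
    (Primrec.fst.comp Primrec.snd).pair
      (Primrec.nat_add.comp (Primrec.snd.comp Primrec.snd) (hn.comp Primrec.fst))
  have ht : Primrec fun y : α × Fin 2 × ℕ × ℕ => (y.2.1, y.2.2.1 + n y.1, y.2.2.2 + n y.1) :=
    (Primrec.fst.comp Primrec.snd).pair
      ((Primrec.nat_add.comp (Primrec.fst.comp (Primrec.snd.comp Primrec.snd))
        (hn.comp Primrec.fst)).pair
      (Primrec.nat_add.comp (Primrec.snd.comp (Primrec.snd.comp Primrec.snd))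
        (hn.comp Primrec.fst)))
  refine (primrec_instr_casesOn hf (hs.comp (Primrec.sumInl.comp hq)).to₂
    (hs.comp (Primrec.sumInr.comp (Primrec.sumInl.comp hq))).to₂
    (hs.comp (Primrec.sumInr.comp (Primrec.sumInr.comp ht))).to₂).of_eq fun a => ?_
  cases f a <;> rfl

end Primrec

theorem primrec_machineEqs : Primrec machineEqs :=
  Primrec.list_cons.comp (Primrec.const _) (Primrec.list_cons.comp (Primrec.const _)
    (Primrec.list_map Primrec.id
      (primrec_instrEq (Primrec.list_length.comp Primrec.fst) Primrec.snd).to₂))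

theorem primrec_machine_toProd : Primrec Machine.equivProd := Primrec.of_equiv

theorem primrec_code : Primrec Machine.code := Primrec.fst.comp primrec_machine_toProd

theorem primrec_start : Primrec Machine.start :=
  Primrec.fst.comp (Primrec.snd.comp primrec_machine_toProd)

theorem primrec_init (c : Fin 2) : Primrec fun M : Machine => M.init c :=
  Primrec.fin_app.comp (Primrec.snd.comp (Primrec.snd.comp primrec_machine_toProd))
    (Primrec.const c)

theorem primrec_fillCode : Primrec Machine.fillCode := by
  have hs : Primrec Instr.equivSum.symm := Primrec.of_equiv_symm
  have hinc : ∀ c : Fin 2, Primrec (Instr.inc c) := fun c =>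
    hs.comp (Primrec.sumInl.comp ((Primrec.const c).pair Primrec.id))
  exact Primrec.list_append.comp
    (Primrec.list_map (Primrec.list_range.comp (primrec_init 0))
      ((hinc 0).comp (Primrec.succ.comp Primrec.snd)).to₂)
    (Primrec.list_map (Primrec.list_range.comp (primrec_init 1))
      ((hinc 1).comp (Primrec.succ.comp
        (Primrec.nat_add.comp ((primrec_init 0).comp Primrec.fst) Primrec.snd))).to₂)

theorem primrec_zeroInit : Primrec Machine.zeroInit := by
  have hs : Primrec Instr.equivSum.symm := Primrec.of_equiv_symm
  have hm : Primrec Machine.equivProd.symm := Primrec.of_equiv_symm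
  have hl : Primrec fun M : Machine => M.fillCode.length + 1 :=
    Primrec.succ.comp (Primrec.list_length.comp primrec_fillCode)
  have hq := Primrec.nat_add.comp primrec_start hl
  refine hm.comp ((Primrec.list_append.comp primrec_fillCode (Primrec.list_cons.comp
    (hs.comp (Primrec.sumInr.comp (Primrec.sumInr.comp ((Primrec.const 0).pair (hq.pair hq)))))
    (Primrec.list_map primrec_code
      (primrec_instr_shift (hl.comp Primrec.fst) Primrec.snd).to₂))).pair
    (Primrec.const (0, fun _ => 0)))

/-- No computability of `g` is needed: only finitely many of its values occur, and they enter as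
constants. -/
theorem primrec_machineProgram (g : ℕ → ℕ) : Primrec (machineProgram g) := by
  refine primrec_program (primrec_machineEqs.comp primrec_code)
    (Primrec.list_cons.comp (primrec_seq (Primrec.const _) (primrec_call _
      (primrec_stateId (Primrec.list_length.comp primrec_code) primrec_start)))
      (Primrec.const _))

/-- Names for the global signals: the output and signals that cannot be observed. -/
theorem exists_globals (J : Interface) {out : ℕ} (hout : out ∈ J.output) (hin : out ∉ J.input) :
    ∃ g : ℕ → ℕ, Function.Injective g ∧ (∀ i, g i ∉ J.input) ∧ g 2 = out := by
  let e := J.infinite_compl.natEmbedding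
  have he : ∀ i, (e i : ℕ) ∉ J.input ∧ (e i : ℕ) ∉ J.output := fun i =>
    not_or.1 (e i).2
  refine ⟨fun i => if i = 2 then out else e i, ?_, ?_, by simp⟩
  · intro i j h
    simp only at h
    split_ifs at h with h1 h2 h2
    · rw [h1, h2]
    · exact absurd (h ▸ hout) (he j).2
    · exact absurd (h ▸ hout) (he i).2
    · exact e.injective (Subtype.ext h)
  · intro i
    simp only
    split_ifs
    · exact hin
    · exact (he i).1

end SL

theorem mainTheorem8 (J : SL.Interface) (out : ℕ) (hout : out ∈ J.output)
    (hin : out ∉ J.input) :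
    ∃ compile : CounterMachine.Machine → SL.Program, Computable compile ∧
      ∀ M : CounterMachine.Machine,
        (compile M).WF ∧
        SL.Reactive J (compile M).eqs ((compile M).threads : Multiset SL.Thread) ∧
        (SL.MustEmit J (compile M).eqs ((compile M).threads : Multiset SL.Thread) out ↔
          M.Terminates) ∧
        (SL.MayEmit J (compile M).eqs ((compile M).threads : Multiset SL.Thread) out ↔
          M.Terminates) := by
  obtain ⟨g, hg, hgJ, rfl⟩ := SL.exists_globals J hout hin
  refine ⟨fun M => SL.machineProgram g M.zeroInit,
    ((SL.primrec_machineProgram g).comp SL.primrec_zeroInit).to_comp, fun M => ?_⟩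
  rw [← M.zeroInit_terminates]
  exact ⟨SL.machineProgram_wf g _, SL.machineProgram_correct hg hgJ hout rfl⟩
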